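/- Let $\Lambda$ be a finite set, $d\in\mathbb N$, let $\Omega\subset\mathbb R^d$ be open, bounded and connected, let $X\subset\Omega$ be compact with non-empty interior, and let $\{\varphi_i\}_{i\in\Lambda}$ be a self-conformal iterated function system on them. That is, for each $i\in\Lambda$, $\varphi_i(\Omega)\subset\Omega$, $\varphi_i(X)\subset X$, $\varphi_i$ is a contraction on $X$ (Lipschitz with a constant smaller than $1$), and $\varphi_i$ is a conformal $C^{1+\varepsilon}$-diffeomorphism of $\Omega$ onto its image for some $\varepsilon>0$: it is injective and differentiable on $\Omega$, its derivative at every point of $\Omega$ is a similarity (a non-zero multiple of a linear isometry), and $x\mapsto\varphi_i'(x)$ is locally $\varepsilon$-Hölder continuous on $\Omega$. Let $F$ be its limit set, i.e. the unique non-empty compact set $F\subset X$ with $F=\bigcup_{i\in\Lambda}\varphi_i(F)$, and assume the strong separation condition: $\varphi_i(F)\cap\varphi_j(F)=\emptyset$ for all $i\neq j$. Let $\Sigma=\Lambda^{\mathbb N}$, for a finite word $\mathbf i$ let $[\mathbf i]\subset\Sigma$ be the set of infinite words that begin with $\mathbf i$, and let $\pi\colon\Sigma\to F$ be the coding map given by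 $\{\pi(\mathbf i)\}=\bigcap_{n}\varphi_{i_1}\circ\cdots\circ\varphi_{i_n}(F)$. Let $\nu$ be a quasi-Bernoulli measure on $\Sigma$, i.e. a Borel probability measure for which there is $C\ge 1$ such that for all finite words $\mathbf i,\mathbf j$, with concatenation $\mathbf i\mathbf j$, $$C^{-1}\nu([\mathbf i])\nu([\mathbf j])\le\nu([\mathbf i\mathbf j])\le C\,\nu([\mathbf i])\nu([\mathbf j]),$$ and let $\mu=\pi_*\nu$. Assume that $\mu$ is fully supported on $F$, i.e. $\operatorname{supp}\mu=F$. With $B(x,r)$ denoting closed balls and $\inf\emptyset=\infty$, let $$\dim_{\mathrm A}\mu=\inf\Big\{s>0:\ \exists C>0\text{ such that for all }x\in \operatorname{supp}\mu,\ 0<r<R,\ \ \frac{\mu(B(x,R))}{\mu(B(x,r))}\le C\Big(\frac Rr\Big)^s\Big\}$$ and, for $x\in F$, $$\dim_{\mathrm A}(\mu,x)=\inf\Big\{s>0:\ \exists C>0\text{ such that for all }0<r<R,\ \ \frac{\mu(B(x,R))}{\mu(B(x,r))}\le C\Big(\frac Rr\Big)^s\Big\}.$$ Then $\dim_{\mathrm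 A}\mu<\infty$, and $\dim_{\mathrm A}(\mu,x)=\dim_{\mathrm A}\mu$ for $\mu$-almost every $x$. -/

import Mathlib

open MeasureTheory Set Filter Topology
open scoped ENNReal NNReal

namespace PointwiseAssouad

section Dimensions

variable {X : Type*} [PseudoMetricSpace X] [MeasurableSpace X]

/-- The (global) Assouad dimension of a measure `μ`: the infimum, in `[0, ∞]`, of all `s > 0` for
which there is `C > 0` with `μ(B(x,R)) / μ(B(x,r)) ≤ C (R/r)^s` for all points `x` of the support
of `μ` and all `0 < r < R`. Balls are closed. The infimum of the empty set is `∞`. -/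
noncomputable def assouadDim (μ : Measure X) : ℝ≥0∞ :=
  sInf {t : ℝ≥0∞ | ∃ s : ℝ, 0 < s ∧ t = ENNReal.ofReal s ∧ ∃ C : ℝ, 0 < C ∧
    ∀ x ∈ μ.support, ∀ r R : ℝ, 0 < r → r < R →
      μ (Metric.closedBall x R) / μ (Metric.closedBall x r) ≤ ENNReal.ofReal (C * (R / r) ^ s)}

/-- The pointwise Assouad dimension of a measure `μ` at a point `x`: as `assouadDim`, but at the
single point `x`, so that the constant `C` may depend on `x`. -/
noncomputable def pointwiseAssouadDim (μ : Measure X) (x : X) : ℝ≥0∞ :=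
  sInf {t : ℝ≥0∞ | ∃ s : ℝ, 0 < s ∧ t = ENNReal.ofReal s ∧ ∃ C : ℝ, 0 < C ∧
    ∀ r R : ℝ, 0 < r → r < R →
      μ (Metric.closedBall x R) / μ (Metric.closedBall x r) ≤ ENNReal.ofReal (C * (R / r) ^ s)}

end Dimensions

section Symbolic

variable {Λ : Type*}

/-- The cylinder `[w]`: all infinite words that begin with the finite word `w`. -/
def cylinder (w : List Λ) : Set (ℕ → Λ) :=
  {i | ∀ (k : ℕ) (hk : k < w.length), i k = w[k]}

/-- The finite word `i|ₙ` of the first `n` letters of the infinite word `i`. -/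
def wordPrefix (i : ℕ → Λ) (n : ℕ) : List Λ :=
  List.ofFn fun k : Fin n => i k

/-- A quasi-Bernoulli measure on the symbolic space `ℕ → Λ`, which carries the product
`σ`-algebra. -/
def IsQuasiBernoulli [MeasurableSpace Λ] (ν : Measure (ℕ → Λ)) : Prop :=
  IsProbabilityMeasure ν ∧ ∃ C : ℝ, 1 ≤ C ∧ ∀ u v : List Λ,
    C⁻¹ * ν.real (cylinder u) * ν.real (cylinder v) ≤ ν.real (cylinder (u ++ v)) ∧
    ν.real (cylinder (u ++ v)) ≤ C * ν.real (cylinder u) * ν.real (cylinder v)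

variable {E : Type*}

/-- The composition `φ_{i₁} ∘ ⋯ ∘ φ_{iₙ}` along the finite word `(i₁, …, iₙ)`. -/
def wordMap (φ : Λ → E → E) : List Λ → E → E
  | [] => id
  | i :: w => φ i ∘ wordMap φ w

/-- The coding map `π`: `π(i)` is the point of `⋂ₙ φ_{i|ₙ}(F)`. For self-conformal iterated
function systems this intersection is a singleton, see `singleton_codingMap`. -/
noncomputable def codingMap [Nonempty E] (φ : Λ → E → E) (F : Set E) (i : ℕ → Λ) : E :=
  Classical.epsilon fun x => x ∈ ⋂ n : ℕ, wordMap φ (wordPrefix i n) '' F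

/-- The strong separation condition. -/
def StrongSeparation (φ : Λ → E → E) (F : Set E) : Prop :=
  ∀ i j : Λ, i ≠ j → Disjoint (φ i '' F) (φ j '' F)

/-- A measure on `E` is quasi-Bernoulli (with respect to the system `φ` with limit set `F`) if it
is the push-forward of a quasi-Bernoulli measure on the symbolic space under the coding map. -/
def IsQuasiBernoulliOn [MeasurableSpace Λ] [MeasurableSpace E] [Nonempty E] (φ : Λ → E → E)
    (F : Set E) (μ : Measure E) : Prop :=
  ∃ ν : Measure (ℕ → Λ), IsQuasiBernoulli ν ∧ μ = ν.map (codingMap φ F)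

end Symbolic

section SelfConformal

variable {Λ : Type*} {d : ℕ}

/-- A self-conformal iterated function system on `ℝᵈ`. Only the values of the maps `φ i` on the
bounded domain `Ω` matter; each `φ i` is a contraction on the compact set `X ⊆ Ω`. That `φ i` is a
conformal `C^{1+ε}` diffeomorphism (onto its image) says that it is injective on `Ω`, that its
derivative at each point of `Ω` is a similarity (a nonzero multiple of a linear isometry), and that
the derivative is `ε`-Hölder continuous (a neighbourhood of each point suffices). -/
structure IsSelfConformalIFS (φ : Λ → EuclideanSpace ℝ (Fin d) → EuclideanSpace ℝ (Fin d))
    (Ω X : Set (EuclideanSpace ℝ (Fin d))) : Prop where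
  isOpen : IsOpen Ω
  isBounded : Bornology.IsBounded Ω
  isConnected : IsConnected Ω
  isCompact : IsCompact X
  subset : X ⊆ Ω
  interior_nonempty : (interior X).Nonempty
  mapsTo_compact : ∀ i, MapsTo (φ i) X X
  contraction : ∀ i, ∃ c : ℝ≥0, c < 1 ∧ LipschitzOnWith c (φ i) X
  mapsTo_domain : ∀ i, MapsTo (φ i) Ω Ω
  injOn : ∀ i, InjOn (φ i) Ω
  conformal : ∀ i, ∀ x ∈ Ω, ConformalAt (φ i) x
  holder : ∀ i, ∃ ε : ℝ≥0, 0 < ε ∧ ∀ x ∈ Ω, ∃ U ∈ 𝓝 x, ∃ C : ℝ≥0,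
    HolderOnWith C ε (fderiv ℝ (φ i)) U

/-- `F` is the limit set of the system `φ` of contractions of the compact set `X`: the (unique)
nonempty compact subset of `X` with `F = ⋃ᵢ φ_i(F)`. -/
structure IsLimitSet {E : Type*} [TopologicalSpace E] (φ : Λ → E → E) (X F : Set E) : Prop where
  isCompact : IsCompact F
  nonempty : F.Nonempty
  subset : F ⊆ X
  eq_iUnion : F = ⋃ i, φ i '' F

theorem wordMap_append {E : Type*} (φ : Λ → E → E) (u v : List Λ) :
    wordMap φ (u ++ v) = wordMap φ u ∘ wordMap φ v := by
  induction u with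
  | nil => rfl
  | cons a u ih => simp [wordMap, ih, Function.comp_assoc]

/-- The defining property of the coding map: `{π(i)} = ⋂ₙ φ_{i|ₙ}(F)`. -/
theorem singleton_codingMap [Finite Λ]
    {φ : Λ → EuclideanSpace ℝ (Fin d) → EuclideanSpace ℝ (Fin d)}
    {Ω X F : Set (EuclideanSpace ℝ (Fin d))} (hφ : IsSelfConformalIFS φ Ω X)
    (hF : IsLimitSet φ X F) (i : ℕ → Λ) :
    {codingMap φ F i} = ⋂ n : ℕ, wordMap φ (wordPrefix i n) '' F := by
  classical
  have hFF : ∀ j, MapsTo (φ j) F F := fun j x hx => by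
    rw [hF.eq_iUnion]; exact mem_iUnion.2 ⟨j, mem_image_of_mem _ hx⟩
  choose c hc1 hcL using hφ.contraction
  have : Nonempty Λ := ⟨i 0⟩
  have := Fintype.ofFinite Λ
  obtain ⟨j₀, hj₀⟩ := Finite.exists_max c
  set K := c j₀
  have hL : ∀ w : List Λ, LipschitzOnWith (K ^ w.length) (wordMap φ w) F ∧
      MapsTo (wordMap φ w) F F := by
    intro w
    induction w with
    | nil => exact ⟨by simpa [wordMap] using LipschitzWith.id.lipschitzOnWith, fun x hx => hx⟩
    | cons a w ih =>
      refine ⟨?_, (hFF a).comp ih.2⟩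
      have h1 : LipschitzOnWith K (φ a) F := ((hcL a).mono hF.subset).weaken (hj₀ a)
      simpa [wordMap, pow_succ'] using h1.comp ih.1 ih.2
  have hne : (⋂ n : ℕ, wordMap φ (wordPrefix i n) '' F).Nonempty := by
    apply IsCompact.nonempty_iInter_of_sequence_nonempty_isCompact_isClosed
    · intro n
      have : wordPrefix i (n + 1) = wordPrefix i n ++ [i n] := by
        rw [wordPrefix, List.ofFn_succ_last]; simp [wordPrefix]
      rw [this, wordMap_append, image_comp]
      exact image_mono (hFF (i n)).image_subset
    · exact fun n => hF.nonempty.image _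
    · exact hF.isCompact.image_of_continuousOn (hL _).1.continuousOn
    · exact fun n => (hF.isCompact.image_of_continuousOn (hL _).1.continuousOn).isClosed
  have hmem : codingMap φ F i ∈ ⋂ n : ℕ, wordMap φ (wordPrefix i n) '' F :=
    Classical.epsilon_spec hne
  refine Subset.antisymm (singleton_subset_iff.2 hmem) fun y hy => ?_
  rw [mem_singleton_iff, ← dist_le_zero]
  have hlim : Tendsto (fun n : ℕ => (K : ℝ) ^ n * Metric.diam F) atTop (𝓝 0) := by
    simpa using (tendsto_pow_atTop_nhds_zero_of_lt_one K.2
      (by exact_mod_cast hc1 j₀)).mul_const (Metric.diam F)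
  refine ge_of_tendsto' hlim fun n => ?_
  obtain ⟨a, ha, hay⟩ := mem_iInter.1 hy n
  obtain ⟨b, hb, hbx⟩ := mem_iInter.1 hmem n
  rw [← hay, ← hbx]
  have h := (hL (wordPrefix i n)).1.dist_le_mul a ha b hb
  have hlen : (wordPrefix i n).length = n := by simp [wordPrefix]
  rw [hlen] at h
  push_cast at h
  exact h.trans (by
    gcongr
    exact Metric.dist_le_diam_of_mem hF.isCompact.isBounded ha hb)

end SelfConformal

end PointwiseAssouad

/-! Bounded distortion and strong separation make every `wordMap φ w` a similarity on `F` up to one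
constant, and isolate each piece in `F` at a distance comparable to its ratio
(`exists_isQuasiSimilar`, `le_dist_of_notMem_piece`). Quasi-Bernoullicity makes masses of pieces
multiplicative up to a constant (`exists_isQuasiMultiplicative`). Hence zooming in by a word `w`
changes ratios of masses of balls only by a bounded factor and a bounded change of radii.

Almost every `x` has every finite word in its coding (`ae_exists_mem_piece_append`). Given `y ∈ F`
and `r < R`, some image of a small piece around `y` therefore contains `x`, and a power law at `x`
yields one at `y` with the same exponent and a constant independent of `y`, `r`, `R`
(`exists_forall_ball_le_of_typical`). So the exponents admissible at `x` are admissible globally;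
the converse is trivial on the support.

Finiteness is the doubling property (`exists_doubling`): the part of `F` in a ball lies in a piece
that has, boundedly many letters deeper, a subpiece inside the ball of half the radius. -/

namespace PointwiseAssouad

/-! ### Separated systems of uniform quasi-similarities -/

section Geometry

variable {Λ E : Type*}

/-- The piece `φ_w(F)` of the limit set. -/
def piece (φ : Λ → E → E) (F : Set E) (w : List Λ) : Set E := wordMap φ w '' F

/-- A separated system of contractions on `F` whose compositions are similarities on `F` up to a
uniform multiplicative constant `K`, with ratio `ρ w` for the word `w`. -/
structure IsQuasiSimilar [MetricSpace E] (φ : Λ → E → E) (F : Set E) (K c δ : ℝ)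
    (ρ : List Λ → ℝ) : Prop where
  isCompact : IsCompact F
  nonempty : F.Nonempty
  eq_iUnion : F = ⋃ i, φ i '' F
  one_le : 1 ≤ K
  c_pos : 0 < c
  c_lt_one : c < 1
  contraction : ∀ i, ∀ x ∈ F, ∀ y ∈ F, dist (φ i x) (φ i y) ≤ c * dist x y
  ratio_pos : ∀ w, 0 < ρ w
  upper : ∀ w, ∀ x ∈ F, ∀ y ∈ F, dist (wordMap φ w x) (wordMap φ w y) ≤ K * ρ w * dist x y
  lower : ∀ w, ∀ x ∈ F, ∀ y ∈ F, ρ w * dist x y ≤ K * dist (wordMap φ w x) (wordMap φ w y)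
  sep_pos : 0 < δ
  sep : ∀ i j, i ≠ j → ∀ x ∈ F, ∀ y ∈ F, δ ≤ dist (φ i x) (φ j y)

theorem piece_nil (φ : Λ → E → E) (F : Set E) : piece φ F [] = F := by simp [piece, wordMap]

theorem piece_append (φ : Λ → E → E) (F : Set E) (u v : List Λ) :
    piece φ F (u ++ v) = wordMap φ u '' piece φ F v := by
  rw [piece, wordMap_append, image_comp, piece]

theorem piece_cons (φ : Λ → E → E) (F : Set E) (i : Λ) (v : List Λ) :
    piece φ F (i :: v) = φ i '' piece φ F v := by
  simp [piece, wordMap, image_comp]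

theorem exists_split_of_notMem_piece {φ : Λ → E → E} {F : Set E} {w : List Λ} {z : E} (hz : z ∈ F)
    (hzw : z ∉ piece φ F w) : ∃ (u v : List Λ) (j : Λ), w = u ++ j :: v ∧ z ∈ piece φ F u ∧
      z ∉ piece φ F (u ++ [j]) := by
  induction w using List.reverseRecOn with
  | nil => rw [piece_nil] at hzw; exact absurd hz hzw
  | append_singleton w j ih =>
    by_cases hw : z ∈ piece φ F w
    · exact ⟨w, [], j, rfl, hw, hzw⟩
    · obtain ⟨u, v, i, rfl, h1, h2⟩ := ih hw
      exact ⟨u, v ++ [j], i, by simp, h1, h2⟩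

theorem nonempty_of_eq_iUnion {φ : Λ → E → E} {F : Set E} (hF : F.Nonempty)
    (h : F = ⋃ i, φ i '' F) : Nonempty Λ := by
  obtain ⟨x, hx⟩ := hF
  rw [h] at hx
  exact ⟨(mem_iUnion.1 hx).choose⟩

namespace IsQuasiSimilar

variable [MetricSpace E] {φ : Λ → E → E} {F : Set E} {K c δ : ℝ} {ρ : List Λ → ℝ}

theorem mapsTo_letter (h : IsQuasiSimilar φ F K c δ ρ) (i : Λ) : MapsTo (φ i) F F := by
  intro x hx
  rw [h.eq_iUnion]
  exact mem_iUnion.2 ⟨i, mem_image_of_mem _ hx⟩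

theorem mapsTo (h : IsQuasiSimilar φ F K c δ ρ) (w : List Λ) : MapsTo (wordMap φ w) F F := by
  induction w with
  | nil => exact fun x hx => hx
  | cons a w ih => exact (h.mapsTo_letter a).comp ih

theorem piece_subset (h : IsQuasiSimilar φ F K c δ ρ) (w : List Λ) : piece φ F w ⊆ F :=
  (h.mapsTo w).image_subset

theorem piece_append_subset (h : IsQuasiSimilar φ F K c δ ρ) (u v : List Λ) :
    piece φ F (u ++ v) ⊆ piece φ F u := by
  rw [piece_append]
  exact image_mono (h.piece_subset v)

theorem dist_wordMap_le (h : IsQuasiSimilar φ F K c δ ρ) (w : List Λ) {x y : E}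
    (hx : x ∈ F) (hy : y ∈ F) :
    dist (wordMap φ w x) (wordMap φ w y) ≤ c ^ w.length * dist x y := by
  induction w with
  | nil => simp [wordMap]
  | cons a w ih =>
    calc dist (φ a (wordMap φ w x)) (φ a (wordMap φ w y))
        ≤ c * dist (wordMap φ w x) (wordMap φ w y) :=
          h.contraction a _ (h.mapsTo w hx) _ (h.mapsTo w hy)
      _ ≤ c * (c ^ w.length * dist x y) := by
          have := h.c_pos
          gcongr
      _ = c ^ (a :: w).length * dist x y := by rw [List.length_cons]; ring

theorem isCompact_piece (h : IsQuasiSimilar φ F K c δ ρ) (w : List Λ) :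
    IsCompact (piece φ F w) := by
  refine h.isCompact.image_of_continuousOn (LipschitzOnWith.continuousOn
    (K := ⟨c ^ w.length, pow_nonneg h.c_pos.le _⟩) ?_)
  exact LipschitzOnWith.of_dist_le_mul fun x hx y hy => h.dist_wordMap_le w hx hy

theorem dist_le_diam (h : IsQuasiSimilar φ F K c δ ρ) {x y : E} (hx : x ∈ F) (hy : y ∈ F) :
    dist x y ≤ Metric.diam F :=
  Metric.dist_le_diam_of_mem h.isCompact.isBounded hx hy

theorem dist_le_of_mem_piece (h : IsQuasiSimilar φ F K c δ ρ) (w : List Λ) {x y : E}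
    (hx : x ∈ piece φ F w) (hy : y ∈ piece φ F w) :
    dist x y ≤ c ^ w.length * Metric.diam F := by
  obtain ⟨a, ha, rfl⟩ := hx
  obtain ⟨b, hb, rfl⟩ := hy
  exact (h.dist_wordMap_le w ha hb).trans
    (mul_le_mul_of_nonneg_left (h.dist_le_diam ha hb) (pow_nonneg h.c_pos.le _))

theorem exists_piece_small (h : IsQuasiSimilar φ F K c δ ρ) {r : ℝ} (hr : 0 < r) :
    ∃ N : ℕ, c ^ N * Metric.diam F ≤ r := by
  have hlim : Tendsto (fun n : ℕ => c ^ n * Metric.diam F) atTop (𝓝 0) := by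
    simpa using (tendsto_pow_atTop_nhds_zero_of_lt_one h.c_pos.le h.c_lt_one).mul_const
      (Metric.diam F)
  obtain ⟨N, hN⟩ := (hlim.eventually (gt_mem_nhds hr)).exists
  exact ⟨N, hN.le⟩

theorem exists_mem_piece (h : IsQuasiSimilar φ F K c δ ρ) (n : ℕ) {x : E} (hx : x ∈ F) :
    ∃ w : List Λ, w.length = n ∧ x ∈ piece φ F w := by
  induction n generalizing x with
  | zero => exact ⟨[], rfl, by rwa [piece_nil]⟩
  | succ n ih =>
    rw [h.eq_iUnion] at hx
    obtain ⟨i, y, hy, rfl⟩ := mem_iUnion.1 hx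
    obtain ⟨w, hw, hyw⟩ := ih hy
    exact ⟨i :: w, by simp [hw], by rw [piece_cons]; exact mem_image_of_mem _ hyw⟩

theorem exists_mem_piece_append (h : IsQuasiSimilar φ F K c δ ρ) (n : ℕ) {x : E} {u : List Λ}
    (hx : x ∈ piece φ F u) : ∃ w : List Λ, w.length = n ∧ x ∈ piece φ F (u ++ w) := by
  obtain ⟨y, hy, rfl⟩ := hx
  obtain ⟨w, hw, hyw⟩ := h.exists_mem_piece n hy
  exact ⟨w, hw, by rw [piece_append]; exact mem_image_of_mem _ hyw⟩

theorem injOn (h : IsQuasiSimilar φ F K c δ ρ) (w : List Λ) : InjOn (wordMap φ w) F := by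
  intro x hx y hy hxy
  have h1 := h.lower w x hx y hy
  rw [hxy, dist_self, mul_zero] at h1
  exact dist_le_zero.1 (nonpos_of_mul_nonpos_right h1 (h.ratio_pos w))

theorem disjoint_piece (h : IsQuasiSimilar φ F K c δ ρ) {u v : List Λ}
    (hl : u.length = v.length) (huv : u ≠ v) : Disjoint (piece φ F u) (piece φ F v) := by
  induction u generalizing v with
  | nil => exact absurd (List.length_eq_zero_iff.1 hl.symm).symm huv
  | cons i u ih =>
    cases v with
    | nil => simp at hl
    | cons j v =>
      rw [Set.disjoint_left, piece_cons, piece_cons]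
      rintro _ ⟨x, hx, rfl⟩ ⟨y, hy, hxy⟩
      have hxF := h.piece_subset u hx
      have hyF := h.piece_subset v hy
      by_cases hij : i = j
      · subst hij
        have : y = x := h.injOn [i] hyF hxF hxy
        subst this
        exact Set.disjoint_left.1 (ih (by simpa using hl) (fun e => huv (by rw [e]))) hx hy
      · have := h.sep i j hij x hxF y hyF
        rw [hxy, dist_self] at this
        exact absurd h.sep_pos this.not_gt

/-- Test both ratios on the images of two distinct points of `F`, using that `wordMap φ v` does not
increase distances. On a one-point set the ratios would be arbitrary. -/
theorem ratio_append_le (h : IsQuasiSimilar φ F K c δ ρ) (hF : F.Nontrivial) (u v : List Λ) :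
    ρ (u ++ v) ≤ K ^ 2 * ρ u := by
  obtain ⟨p, hp, q, hq, hpq⟩ := hF
  have hK := h.one_le
  have hd : 0 < dist p q := dist_pos.2 hpq
  have h1 := h.lower (u ++ v) p hp q hq
  have h2 := h.upper u _ (h.mapsTo v hp) _ (h.mapsTo v hq)
  have h3 : dist (wordMap φ v p) (wordMap φ v q) ≤ dist p q :=
    (h.dist_wordMap_le v hp hq).trans
      (mul_le_of_le_one_left hd.le (pow_le_one₀ h.c_pos.le h.c_lt_one.le))
  rw [wordMap_append] at h1
  refine le_of_mul_le_mul_right (h1.trans ?_) hd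
  have hu := h.ratio_pos u
  calc K * dist (wordMap φ u (wordMap φ v p)) (wordMap φ u (wordMap φ v q))
      ≤ K * (K * ρ u * dist p q) := by
        gcongr
        exact h2.trans (by gcongr)
    _ = K ^ 2 * ρ u * dist p q := by ring

/-- The piece `φ_w(F)` is separated from the rest of `F` relative to its size. -/
theorem le_dist_of_notMem_piece (h : IsQuasiSimilar φ F K c δ ρ) {w : List Λ} {x z : E}
    (hx : x ∈ piece φ F w) (hz : z ∈ F) (hzw : z ∉ piece φ F w) :
    δ / K ^ 3 * ρ w ≤ dist x z := by
  have hK : 0 < K := one_pos.trans_le h.one_le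
  have hxz : x ≠ z := fun e => hzw (e ▸ hx)
  have hnt : F.Nontrivial := ⟨x, h.piece_subset w hx, z, hz, hxz⟩
  -- Go back to a prefix `u` where `z` still shares the piece of `x` but leaves it at the next
  -- letter. The preimages under `φ_u` lie in different first-level pieces, so they are `δ` apart.
  -- Of the factor `K ^ 3`, `K` comes from applying `φ_u` and `K ^ 2` from comparing the ratios of
  -- `w` and `u`.
  obtain ⟨u, v, j, rfl, hzu, hzj⟩ := exists_split_of_notMem_piece hz hzw
  have hρ := h.ratio_append_le hnt u (j :: v)
  rw [piece_append] at hx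
  obtain ⟨x', hx', rfl⟩ := hx
  obtain ⟨z', hz', rfl⟩ := hzu
  have hx'F := h.piece_subset _ hx'
  have hδ : δ ≤ dist x' z' := by
    rw [piece_cons] at hx'
    obtain ⟨x'', hx'', rfl⟩ := hx'
    have hz'' := hz'
    rw [h.eq_iUnion] at hz''
    obtain ⟨i, y, hy, rfl⟩ := mem_iUnion.1 hz''
    refine h.sep j i (fun e => hzj ?_) _ (h.piece_subset _ hx'') _ hy
    rw [piece_append, piece_cons, piece_nil, e]
    exact mem_image_of_mem _ (mem_image_of_mem _ hy)
  have h1 := h.lower u x' hx'F z' hz'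
  have hu := h.ratio_pos u
  have hδ0 := h.sep_pos
  rw [div_mul_eq_mul_div, div_le_iff₀ (by positivity)]
  calc δ * ρ (u ++ j :: v) ≤ δ * (K ^ 2 * ρ u) := by gcongr
    _ = K ^ 2 * (ρ u * δ) := by ring
    _ ≤ K ^ 2 * (ρ u * dist x' z') := by gcongr
    _ ≤ K ^ 2 * (K * dist (wordMap φ u x') (wordMap φ u z')) := by gcongr
    _ = dist (wordMap φ u x') (wordMap φ u z') * K ^ 3 := by ring

end IsQuasiSimilar

end Geometry

/-! ### Quasi-multiplicative masses and transfer from a typical point -/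

section Mass

variable {Λ E : Type*} [MeasurableSpace E]

/-- A probability measure on `F` whose masses of pieces are positive and multiplicative up to a
constant. -/
structure IsQuasiMultiplicative (φ : Λ → E → E) (F : Set E) (μ : Measure E) (C : ℝ) : Prop where
  isProbabilityMeasure : IsProbabilityMeasure μ
  compl : μ Fᶜ = 0
  one_le : 1 ≤ C
  lower : ∀ u v, μ.real (piece φ F u) * μ.real (piece φ F v) ≤ C * μ.real (piece φ F (u ++ v))
  upper : ∀ u v, μ.real (piece φ F (u ++ v)) ≤ C * μ.real (piece φ F u) * μ.real (piece φ F v)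
  pos : ∀ w, 0 < μ.real (piece φ F w)

variable {φ : Λ → E → E} {F : Set E} {μ : Measure E} {C : ℝ}

namespace IsQuasiMultiplicative

theorem measureReal_le_of_inter_subset (hm : IsQuasiMultiplicative φ F μ C) {A B : Set E}
    (hAB : A ∩ F ⊆ B) : μ.real A ≤ μ.real B := by
  have := hm.isProbabilityMeasure
  refine ENNReal.toReal_mono (measure_ne_top _ _) ?_
  calc μ A ≤ μ (B ∪ Fᶜ) := measure_mono fun x hx => by
        by_cases hxF : x ∈ F
        · exact Or.inl (hAB ⟨hx, hxF⟩)
        · exact Or.inr hxF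
    _ ≤ μ B + μ Fᶜ := measure_union_le _ _
    _ = μ B := by rw [hm.compl, add_zero]

theorem measureReal_eq_one (hm : IsQuasiMultiplicative φ F μ C) {A : Set E} (hA : F ⊆ A) :
    μ.real A = 1 := by
  have := hm.isProbabilityMeasure
  refine le_antisymm measureReal_le_one ?_
  rw [← probReal_univ (μ := μ)]
  exact hm.measureReal_le_of_inter_subset (by simpa using hA)

end IsQuasiMultiplicative

variable [MetricSpace E] [BorelSpace E] {K c δ : ℝ} {ρ : List Λ → ℝ}

namespace IsQuasiSimilar

theorem measureReal_biUnion_piece (h : IsQuasiSimilar φ F K c δ ρ) [IsFiniteMeasure μ]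
    (u : List Λ) {W : Finset (List Λ)} {N : ℕ} (hW : ∀ v ∈ W, v.length = N) :
    μ.real (⋃ v ∈ W, piece φ F (u ++ v)) = ∑ v ∈ W, μ.real (piece φ F (u ++ v)) := by
  refine measureReal_biUnion_finset (fun v hv v' hv' hne => ?_)
    fun v _ => (h.isCompact_piece _).measurableSet
  exact h.disjoint_piece (by simp [hW v hv, hW v' hv']) (by simpa using hne)

end IsQuasiSimilar

namespace IsQuasiMultiplicative

/-- The mass of a set that is covered inside `φ_u(F)` by pieces whose `φ_u`-preimages lie
in `A`. -/
theorem measureReal_le_mul (hm : IsQuasiMultiplicative φ F μ C) (h : IsQuasiSimilar φ F K c δ ρ)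
    (u : List Λ) {W : Finset (List Λ)} {N : ℕ} (hW : ∀ v ∈ W, v.length = N) {S A : Set E}
    (hS : S ∩ F ⊆ ⋃ v ∈ W, piece φ F (u ++ v)) (hA : ∀ v ∈ W, piece φ F v ⊆ A) :
    μ.real S ≤ C * μ.real (piece φ F u) * μ.real A := by
  have := hm.isProbabilityMeasure
  have hC := hm.one_le
  calc μ.real S ≤ ∑ v ∈ W, μ.real (piece φ F (u ++ v)) := by
        rw [← h.measureReal_biUnion_piece u hW]
        exact hm.measureReal_le_of_inter_subset hS
    -- Writing `[] ++ v` lets the additivity lemma for pieces be reused with the empty prefix.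
    _ ≤ ∑ v ∈ W, C * μ.real (piece φ F u) * μ.real (piece φ F ([] ++ v)) :=
        Finset.sum_le_sum fun v _ => hm.upper u v
    _ = C * μ.real (piece φ F u) * μ.real (⋃ v ∈ W, piece φ F ([] ++ v)) := by
        rw [h.measureReal_biUnion_piece [] hW, Finset.mul_sum]
    _ ≤ C * μ.real (piece φ F u) * μ.real A := by
        gcongr
        · finiteness
        · exact iUnion₂_subset hA

/-- The mass of a set that contains the `φ_u`-images of pieces covering `A`. -/
theorem mul_le_measureReal (hm : IsQuasiMultiplicative φ F μ C) (h : IsQuasiSimilar φ F K c δ ρ)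
    (u : List Λ) {W : Finset (List Λ)} {N : ℕ} (hW : ∀ v ∈ W, v.length = N) {S A : Set E}
    (hA : A ∩ F ⊆ ⋃ v ∈ W, piece φ F v) (hS : ∀ v ∈ W, piece φ F (u ++ v) ⊆ S) :
    μ.real (piece φ F u) * μ.real A ≤ C * μ.real S := by
  have := hm.isProbabilityMeasure
  have hC := hm.one_le
  calc μ.real (piece φ F u) * μ.real A
      ≤ μ.real (piece φ F u) * ∑ v ∈ W, μ.real (piece φ F ([] ++ v)) := by
        rw [← h.measureReal_biUnion_piece [] hW]
        gcongr μ.real (piece φ F u) * ?_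
        exact hm.measureReal_le_of_inter_subset hA
    _ ≤ ∑ v ∈ W, C * μ.real (piece φ F (u ++ v)) := by
        rw [Finset.mul_sum]
        exact Finset.sum_le_sum fun v _ => hm.lower u v
    _ = C * μ.real (⋃ v ∈ W, piece φ F (u ++ v)) := by
        rw [h.measureReal_biUnion_piece u hW, Finset.mul_sum]
    _ ≤ C * μ.real S := by
        gcongr
        · finiteness
        · exact iUnion₂_subset hS

/-- Almost every point has the image of every piece in its symbolic orbit. -/
theorem ae_exists_mem_piece_append [Finite Λ] (hm : IsQuasiMultiplicative φ F μ C)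
    (h : IsQuasiSimilar φ F K c δ ρ) :
    ∀ᵐ x ∂μ, ∀ u : List Λ, ∃ v : List Λ, x ∈ piece φ F (v ++ u) := by
  classical
  have := hm.isProbabilityMeasure
  have hC := hm.one_le
  rw [ae_all_iff]
  intro u
  set Z : Set E := {x | ¬ ∃ v : List Λ, x ∈ piece φ F (v ++ u)} with hZ
  set p : ℝ := C⁻¹ * μ.real (piece φ F u) with hp
  have hp0 : 0 < p := mul_pos (inv_pos.2 (one_pos.trans_le hC)) (hm.pos u)
  have hp1 : p ≤ 1 := mul_le_one₀ (inv_le_one_of_one_le₀ hC) measureReal_nonneg measureReal_le_one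
  have hfin := List.finite_length_eq Λ u.length
  set T : Finset (List Λ) := hfin.toFinset with hT
  have hTl : ∀ v ∈ T, v.length = u.length := fun v hv => by simpa [hT] using hv
  have huT : u ∈ T := by simp [hT]
  -- Inside any piece the block `u` comes next with conditional mass at least `p`. Points of `Z`
  -- avoid it in each of `k` successive blocks of length `u.length`, whatever came before.
  have key : ∀ (k : ℕ) (w : List Λ),
      μ.real (piece φ F w ∩ Z) ≤ (1 - p) ^ k * μ.real (piece φ F w) := by
    intro k
    induction k with
    | zero =>
      intro w
      rw [pow_zero, one_mul]
      exact measureReal_mono inter_subset_left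
    | succ k ih =>
      intro w
      have hsum : ∑ v ∈ T, μ.real (piece φ F (w ++ v)) ≤ μ.real (piece φ F w) := by
        rw [← h.measureReal_biUnion_piece w hTl]
        exact measureReal_mono (iUnion₂_subset fun v _ => h.piece_append_subset w v)
      rw [← Finset.add_sum_erase _ _ huT] at hsum
      have hlow : p * μ.real (piece φ F w) ≤ μ.real (piece φ F (w ++ u)) := by
        have := hm.lower w u
        rw [hp, inv_mul_eq_div, div_mul_eq_mul_div, div_le_iff₀ (by linarith)]
        linarith
      calc μ.real (piece φ F w ∩ Z)
          ≤ μ.real (⋃ v ∈ T.erase u, (piece φ F (w ++ v) ∩ Z)) := by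
            refine measureReal_mono ?_ (measure_ne_top _ _)
            rintro x ⟨hxw, hxZ⟩
            obtain ⟨v, hvl, hxv⟩ := h.exists_mem_piece_append u.length hxw
            have hne : v ≠ u := by
              rintro rfl
              exact hxZ ⟨w, hxv⟩
            exact mem_iUnion₂.2 ⟨v, Finset.mem_erase.2 ⟨hne, by simp [hT, hvl]⟩, hxv, hxZ⟩
        _ ≤ ∑ v ∈ T.erase u, μ.real (piece φ F (w ++ v) ∩ Z) := measureReal_biUnion_finset_le _ _
        _ ≤ ∑ v ∈ T.erase u, (1 - p) ^ k * μ.real (piece φ F (w ++ v)) :=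
            Finset.sum_le_sum fun v _ => ih (w ++ v)
        _ = (1 - p) ^ k * ∑ v ∈ T.erase u, μ.real (piece φ F (w ++ v)) := by
            rw [Finset.mul_sum]
        _ ≤ (1 - p) ^ k * ((1 - p) * μ.real (piece φ F w)) := by
            have : 0 ≤ 1 - p := by linarith
            gcongr
            linarith
        _ = (1 - p) ^ (k + 1) * μ.real (piece φ F w) := by ring
  have hlim : Tendsto (fun k : ℕ => (1 - p) ^ k * μ.real (piece φ F [])) atTop (𝓝 0) := by
    simpa using (tendsto_pow_atTop_nhds_zero_of_lt_one (by linarith : 0 ≤ 1 - p)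
      (by linarith)).mul_const (μ.real (piece φ F []))
  have hzero : μ.real Z ≤ 0 := by
    refine (hm.measureReal_le_of_inter_subset ?_).trans (ge_of_tendsto' hlim fun k => key k [])
    rw [piece_nil, inter_comm]
  rw [ae_iff]
  exact (measureReal_eq_zero_iff (measure_ne_top _ _)).1 (le_antisymm hzero measureReal_nonneg)

/-- If the images of all pieces are in the symbolic orbit of `x`, then a power law for ratios of
measures of balls about `x` implies such a law, with the same exponent, at all points of `F`. -/
theorem exists_forall_ball_le_of_typical [Finite Λ] (hm : IsQuasiMultiplicative φ F μ C)
    (h : IsQuasiSimilar φ F K c δ ρ) {x : E} (hx : ∀ u : List Λ, ∃ v, x ∈ piece φ F (v ++ u))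
    {s A : ℝ} (hs : 0 < s) (hA : 0 < A)
    (hxA : ∀ r R : ℝ, 0 < r → r < R →
      μ.real (Metric.closedBall x R) ≤ A * (R / r) ^ s * μ.real (Metric.closedBall x r)) :
    ∃ B : ℝ, 0 < B ∧ ∀ y ∈ F, ∀ r R : ℝ, 0 < r → r < R →
      μ.real (Metric.closedBall y R) ≤ B * (R / r) ^ s * μ.real (Metric.closedBall y r) := by
  have := hm.isProbabilityMeasure
  have hC := hm.one_le
  have hK := h.one_le
  have hδ := h.sep_pos
  set κ : ℝ := δ / K ^ 3 with hκ
  have hκ0 : 0 < κ := by positivity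
  set D : ℝ := Metric.diam F + 1 with hD
  have hD0 : 0 < D := by have := Metric.diam_nonneg (s := F); linarith
  -- `α * D < κ` keeps the part of `F` in the small ball about `x` inside `φ_w(F)` when `r < D`; `K
  -- * α ≤ 1 / 4` makes its preimage lie within `r / 4` of the preimage of `x`.
  obtain ⟨α, hα0, hα1, hακ⟩ : ∃ α : ℝ, 0 < α ∧ K * α ≤ 1 / 4 ∧ α * D < κ := by
    refine ⟨min (1 / (4 * K)) (κ / (2 * D)), by positivity, ?_, ?_⟩
    · calc K * min (1 / (4 * K)) (κ / (2 * D)) ≤ K * (1 / (4 * K)) := by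
            gcongr
            exact min_le_left _ _
        _ = 1 / 4 := by field_simp
    · calc min (1 / (4 * K)) (κ / (2 * D)) * D ≤ κ / (2 * D) * D := by
            gcongr
            exact min_le_right _ _
        _ = κ / 2 := by field_simp
        _ < κ := by linarith
  have hα14 : α ≤ 1 / 4 := by nlinarith
  refine ⟨max 1 (C ^ 2 * A * (2 * K / α) ^ s), by positivity, fun y hy r R hr hrR => ?_⟩
  have hRr : 1 ≤ R / r := (one_le_div hr).2 hrR.le
  have hRrs : 1 ≤ (R / r) ^ s := Real.one_le_rpow hRr hs.le
  -- If `r ≥ D`, the smaller ball already contains `F`.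
  rcases le_or_gt D r with hDr | hDr
  · have hball : μ.real (Metric.closedBall y r) = 1 := by
      refine hm.measureReal_eq_one fun z hz => ?_
      have := h.dist_le_diam hz hy
      exact Metric.mem_closedBall.2 (by linarith)
    rw [hball, mul_one]
    calc μ.real (Metric.closedBall y R) ≤ 1 * 1 := by
          rw [one_mul]; exact measureReal_le_one
      _ ≤ max 1 (C ^ 2 * A * (2 * K / α) ^ s) * (R / r) ^ s := by
          gcongr
          exact le_max_left _ _
  obtain ⟨N, hN⟩ := h.exists_piece_small (r := r / 4) (by positivity)
  have hsmall : ∀ w : List Λ, w.length = N → ∀ a ∈ piece φ F w, ∀ b ∈ piece φ F w,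
      dist a b ≤ r / 4 := fun w hw a ha b hb => by
    have := h.dist_le_of_mem_piece w ha hb
    rw [hw] at this
    exact this.trans hN
  -- Code `y` down to scale `r / 4` by `η`; typicality gives `x = φ_w(y')` with `y'` in the same
  -- small piece as `y`.
  obtain ⟨η, hηl, hyη⟩ := h.exists_mem_piece N hy
  obtain ⟨w, hxw⟩ := hx η
  rw [piece_append] at hxw
  obtain ⟨y', hy', rfl⟩ := hxw
  have hy'F := h.piece_subset η hy'
  have hyy' : dist y y' ≤ r / 4 := hsmall η hηl _ hyη _ hy'
  have hw0 := h.ratio_pos w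
  set x := wordMap φ w y' with hxdef
  have hfin := List.finite_length_eq Λ N
  classical
  -- Level-`N` words whose pieces meet the ball of radius `t` about `y`. Their pieces cover the part
  -- of `F` in that ball and overshoot it by at most `r / 4`.
  let W : ℝ → Finset (List Λ) := fun t =>
    hfin.toFinset.filter fun v => (piece φ F v ∩ Metric.closedBall y t).Nonempty
  have hWl : ∀ t, ∀ v ∈ W t, v.length = N := fun t v hv => by
    simpa using (Finset.mem_filter.1 hv).1
  have hWd : ∀ t, ∀ v ∈ W t, ∀ z ∈ piece φ F v, dist z y ≤ t + r / 4 := by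
    intro t v hv z hz
    obtain ⟨b, hb, hbt⟩ := (Finset.mem_filter.1 hv).2
    have h1 := hsmall v (hWl t v hv) z hz b hb
    have h2 := Metric.mem_closedBall.1 hbt
    have := dist_triangle z b y
    linarith
  have hWm : ∀ t, ∀ z ∈ F, dist z y ≤ t → ∃ v ∈ W t, z ∈ piece φ F v := by
    intro t z hz hzt
    obtain ⟨v, hv, hzv⟩ := h.exists_mem_piece N hz
    exact ⟨v, Finset.mem_filter.2 ⟨by simpa using hv, z, hzv, Metric.mem_closedBall.2 hzt⟩, hzv⟩
  have hlow : μ.real (piece φ F w) * μ.real (Metric.closedBall y R) ≤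
      C * μ.real (Metric.closedBall x (2 * K * ρ w * R)) := by
    refine hm.mul_le_measureReal h w (hWl R) ?_ ?_
    · rintro z ⟨hzR, hzF⟩
      obtain ⟨v, hv, hzv⟩ := hWm R z hzF hzR
      exact mem_iUnion₂.2 ⟨v, hv, hzv⟩
    · intro v hv
      rw [piece_append]
      rintro _ ⟨z, hz, rfl⟩
      have h1 := h.upper w z (h.piece_subset v hz) y' hy'F
      have h2 := hWd R v hv z hz
      have h3 := dist_triangle z y y'
      rw [Metric.mem_closedBall]
      calc dist (wordMap φ w z) x ≤ K * ρ w * dist z y' := h1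
        _ ≤ K * ρ w * (2 * R) := by gcongr; linarith
        _ = 2 * K * ρ w * R := by ring
  have hup : μ.real (Metric.closedBall x (α * ρ w * r)) ≤
      C * μ.real (piece φ F w) * μ.real (Metric.closedBall y r) := by
    refine hm.measureReal_le_mul h w (hWl (r / 2)) ?_ ?_
    · rintro ζ ⟨hζ, hζF⟩
      rw [Metric.mem_closedBall] at hζ
      have hmem : ζ ∈ piece φ F w := by
        by_contra hcon
        have h1 := h.le_dist_of_notMem_piece (mem_image_of_mem _ hy'F) hζF hcon
        rw [dist_comm] at h1
        have h2 : α * ρ w * r < κ * ρ w := by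
          calc α * ρ w * r ≤ α * ρ w * D := by gcongr
            _ = α * D * ρ w := by ring
            _ < κ * ρ w := by gcongr
        linarith
      obtain ⟨ξ, hξ, rfl⟩ := hmem
      have h1 := h.lower w ξ hξ y' hy'F
      have h2 : ρ w * dist ξ y' ≤ ρ w * (r / 4) := by
        calc ρ w * dist ξ y' ≤ K * (α * ρ w * r) := h1.trans (by gcongr)
          _ = K * α * (ρ w * r) := by ring
          _ ≤ 1 / 4 * (ρ w * r) := by gcongr
          _ = ρ w * (r / 4) := by ring
      have h3 := le_of_mul_le_mul_left h2 hw0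
      have h4 := dist_triangle_right ξ y y'
      obtain ⟨v, hv, hξv⟩ := hWm (r / 2) ξ hξ (by linarith)
      refine mem_iUnion₂.2 ⟨v, hv, ?_⟩
      rw [piece_append]
      exact mem_image_of_mem _ hξv
    · intro v hv z hz
      have := hWd (r / 2) v hv z hz
      exact Metric.mem_closedBall.2 (by linarith)
  have hr' : 0 < α * ρ w * r := by positivity
  have hrR' : α * ρ w * r < 2 * K * ρ w * R := by
    have : α < 2 * K := by linarith
    gcongr
  have hmid := hxA _ _ hr' hrR'
  -- The ratio `ρ w` cancels, as the mass of `φ_w(F)` will below, so the constant is independent of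
  -- `w`, hence of `y`, `r` and `R`.
  have hquot : 2 * K * ρ w * R / (α * ρ w * r) = 2 * K / α * (R / r) := by field_simp
  rw [hquot, Real.mul_rpow (by positivity) (by positivity)] at hmid
  have hwpos := hm.pos w
  refine le_of_mul_le_mul_left ?_ hwpos
  calc μ.real (piece φ F w) * μ.real (Metric.closedBall y R)
      ≤ C * μ.real (Metric.closedBall x (2 * K * ρ w * R)) := hlow
    _ ≤ C * (A * ((2 * K / α) ^ s * (R / r) ^ s) *
          μ.real (Metric.closedBall x (α * ρ w * r))) := by gcongr
    _ ≤ C * (A * ((2 * K / α) ^ s * (R / r) ^ s) *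
          (C * μ.real (piece φ F w) * μ.real (Metric.closedBall y r))) := by gcongr
    _ = μ.real (piece φ F w) * ((C ^ 2 * A * (2 * K / α) ^ s) * (R / r) ^ s *
          μ.real (Metric.closedBall y r)) := by ring
    _ ≤ _ := by
        gcongr
        exact le_max_right _ _

end IsQuasiMultiplicative

end Mass

/-! ### Doubling, hence finite Assouad dimension -/

section Doubling

/-- Halve the radius `⌈log₂ (R / r)⌉` times; rounding up costs the extra factor `D`. -/
theorem le_mul_rpow_of_doubling {f : ℝ → ℝ} (hf : Monotone f) (hf0 : ∀ t, 0 ≤ f t) {D : ℝ}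
    (hD : 2 ≤ D) (hfD : ∀ R, 0 < R → f R ≤ D * f (R / 2)) {r R : ℝ} (hr : 0 < r) (hrR : r < R) :
    f R ≤ D * (R / r) ^ Real.logb 2 D * f r := by
  have hD0 : 0 < D := by linarith
  have hR : 0 < R := hr.trans hrR
  have hRr : 0 < R / r := div_pos hR hr
  have hlog : 0 ≤ Real.logb 2 (R / r) :=
    Real.logb_nonneg one_lt_two ((one_le_div hr).2 hrR.le)
  have hiter : ∀ k : ℕ, f R ≤ D ^ k * f (R / 2 ^ k) := by
    intro k
    induction k with
    | zero => simp
    | succ k ih =>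
      calc f R ≤ D ^ k * f (R / 2 ^ k) := ih
        _ ≤ D ^ k * (D * f (R / 2 ^ k / 2)) := by
            gcongr
            exact hfD _ (by positivity)
        _ = D ^ (k + 1) * f (R / 2 ^ (k + 1)) := by rw [div_div, ← pow_succ]; ring
  set k := ⌈Real.logb 2 (R / r)⌉₊ with hk
  have hk1 : R / 2 ^ k ≤ r := by
    have h1 : R / r ≤ 2 ^ (k : ℝ) :=
      (Real.logb_le_iff_le_rpow one_lt_two hRr).1 (Nat.le_ceil _)
    rw [Real.rpow_natCast, div_le_iff₀ hr] at h1
    rw [div_le_iff₀ (by positivity)]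
    linarith
  have hk2 : D ^ k ≤ D * (R / r) ^ Real.logb 2 D := by
    have h1 : (k : ℝ) ≤ Real.logb 2 (R / r) + 1 := (Nat.ceil_lt_add_one hlog).le
    calc D ^ k = D ^ (k : ℝ) := (Real.rpow_natCast _ _).symm
      _ ≤ D ^ (Real.logb 2 (R / r) + 1) := Real.rpow_le_rpow_of_exponent_le (by linarith) h1
      _ = D * D ^ Real.logb 2 (R / r) := by rw [Real.rpow_add hD0, Real.rpow_one, mul_comm]
      _ = D * (R / r) ^ Real.logb 2 D := by
          rw [Real.rpow_def_of_pos hD0, Real.rpow_def_of_pos hRr, Real.logb, Real.logb]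
          ring_nf
  calc f R ≤ D ^ k * f (R / 2 ^ k) := hiter k
    _ ≤ D * (R / r) ^ Real.logb 2 D * f r := by
        have := hf0 (R / 2 ^ k)
        gcongr
        exact hf hk1

variable {Λ E : Type*} [MeasurableSpace E] {φ : Λ → E → E} {F : Set E} {μ : Measure E} {C : ℝ}

namespace IsQuasiMultiplicative

/-- Appending one letter keeps at least a fixed fraction of the mass, governed by the lightest of
the finitely many first-level pieces. -/
theorem exists_pow_mul_le [Finite Λ] [Nonempty Λ] (hm : IsQuasiMultiplicative φ F μ C) :
    ∃ p : ℝ, 0 < p ∧ p ≤ 1 ∧ ∀ w v : List Λ,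
      p ^ v.length * μ.real (piece φ F w) ≤ μ.real (piece φ F (w ++ v)) := by
  have := hm.isProbabilityMeasure
  have hC := hm.one_le
  have hC0 : 0 < C := by linarith
  obtain ⟨i₀, hi₀⟩ := Finite.exists_min fun i => μ.real (piece φ F [i])
  refine ⟨C⁻¹ * μ.real (piece φ F [i₀]), mul_pos (inv_pos.2 hC0) (hm.pos _),
    mul_le_one₀ (inv_le_one_of_one_le₀ hC) measureReal_nonneg measureReal_le_one, fun w v => ?_⟩
  induction v generalizing w with
  | nil => simp
  | cons i v ih =>
    have h1 := hm.lower w [i]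
    have h2 : C⁻¹ * μ.real (piece φ F [i₀]) * μ.real (piece φ F w) ≤
        μ.real (piece φ F (w ++ [i])) := by
      rw [mul_assoc, inv_mul_le_iff₀ hC0]
      calc _ ≤ μ.real (piece φ F [i]) * μ.real (piece φ F w) := by
            gcongr ?_ * _
            exact hi₀ i
        _ ≤ _ := by rw [mul_comm]; exact h1
    calc (C⁻¹ * μ.real (piece φ F [i₀])) ^ (i :: v).length * μ.real (piece φ F w)
        = (C⁻¹ * μ.real (piece φ F [i₀])) ^ v.length *
            (C⁻¹ * μ.real (piece φ F [i₀]) * μ.real (piece φ F w)) := by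
          rw [List.length_cons]; ring
      _ ≤ (C⁻¹ * μ.real (piece φ F [i₀])) ^ v.length * μ.real (piece φ F (w ++ [i])) := by
          gcongr
      _ ≤ μ.real (piece φ F (w ++ [i] ++ v)) := ih _
      _ = μ.real (piece φ F (w ++ i :: v)) := by simp

variable [MetricSpace E] {K c δ : ℝ} {ρ : List Λ → ℝ}

/-- Take a shortest word whose piece contains `x` and lies in the half ball. By minimality its
parent piece is not inside that ball, which bounds `R` by the parent's size. A fixed number of
letters further back, the piece is so large that its separation from the rest of `F` exceeds `R`. -/
theorem exists_doubling [Finite Λ] (hm : IsQuasiMultiplicative φ F μ C)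
    (h : IsQuasiSimilar φ F K c δ ρ) :
    ∃ D : ℝ, 2 ≤ D ∧ ∀ x ∈ F, ∀ R : ℝ, 0 < R →
      μ.real (Metric.closedBall x R) ≤ D * μ.real (Metric.closedBall x (R / 2)) := by
  have := hm.isProbabilityMeasure
  have hK := h.one_le
  have hδ := h.sep_pos
  have hc := h.c_pos
  have := nonempty_of_eq_iUnion h.nonempty h.eq_iUnion
  obtain ⟨p, hp0, hp1, hp⟩ := hm.exists_pow_mul_le
  set κ : ℝ := δ / K ^ 3 with hκ
  have hκ0 : 0 < κ := by positivity
  -- With this `l`, a piece `φ_{uv}(F)` with `v.length = l` has diameter at most `κ * ρ u / 2`, half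
  -- the separation bound of `φ_u(F)`.
  obtain ⟨l, hl⟩ := h.exists_piece_small (r := κ / (2 * K)) (by positivity)
  refine ⟨max 2 ((p ^ (l + 1))⁻¹), le_max_left _ _, fun x hx R hR => ?_⟩
  suffices hmain : ∃ u v : List Λ, v.length ≤ l + 1 ∧
      Metric.closedBall x R ∩ F ⊆ piece φ F u ∧
      piece φ F (u ++ v) ⊆ Metric.closedBall x (R / 2) by
    obtain ⟨u, v, hv, hu, huv⟩ := hmain
    have h1 : p ^ (l + 1) ≤ p ^ v.length := pow_le_pow_of_le_one hp0.le hp1 hv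
    calc μ.real (Metric.closedBall x R) ≤ μ.real (piece φ F u) :=
          hm.measureReal_le_of_inter_subset hu
      _ = (p ^ (l + 1))⁻¹ * (p ^ (l + 1) * μ.real (piece φ F u)) := by
          rw [inv_mul_cancel_left₀ (by positivity)]
      _ ≤ (p ^ (l + 1))⁻¹ * (p ^ v.length * μ.real (piece φ F u)) := by gcongr
      _ ≤ (p ^ (l + 1))⁻¹ * μ.real (Metric.closedBall x (R / 2)) := by
          gcongr
          exact (hp u v).trans (measureReal_mono huv)
      _ ≤ _ := by
          gcongr
          exact le_max_right _ _
  have hex : ∃ n : ℕ, ∃ w : List Λ, w.length = n ∧ x ∈ piece φ F w ∧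
      piece φ F w ⊆ Metric.closedBall x (R / 2) := by
    obtain ⟨N, hN⟩ := h.exists_piece_small (r := R / 2) (by positivity)
    obtain ⟨w, hw, hxw⟩ := h.exists_mem_piece N hx
    refine ⟨N, w, hw, hxw, fun z hz => ?_⟩
    have := h.dist_le_of_mem_piece w hz hxw
    rw [hw] at this
    exact Metric.mem_closedBall.2 (this.trans hN)
  classical
  obtain ⟨w, hwl, hxw, hwR⟩ := Nat.find_spec hex
  have hmin := fun m => Nat.find_min hex (m := m)
  set n := Nat.find hex
  rcases le_or_gt n (l + 1) with hn | hn
  · exact ⟨[], w, by omega, by rw [piece_nil]; exact inter_subset_right, by simpa using hwR⟩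
  -- Dropping `l + 1` letters leaves exactly `l` letters between `u` and the parent of `w`.
  set u := w.take (n - (l + 1)) with hu
  refine ⟨u, w.drop (n - (l + 1)), by simp; omega, ?_, by rwa [hu, List.take_append_drop]⟩
  obtain ⟨v, j, hv⟩ : ∃ v j, w.drop (n - (l + 1)) = v ++ [j] := by
    rcases List.eq_nil_or_concat (w.drop (n - (l + 1))) with h0 | ⟨v, j, hvj⟩
    · have := congrArg List.length h0
      simp at this
      omega
    · exact ⟨v, j, by rw [hvj, List.concat_eq_append]⟩
  have hw : w = u ++ v ++ [j] := by
    rw [List.append_assoc, ← hv, hu, List.take_append_drop]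
  have hvl : v.length = l := by
    have := congrArg List.length hv
    simp at this
    omega
  rw [hw] at hxw
  have hx' := h.piece_append_subset _ _ hxw
  have hnot : ¬ piece φ F (u ++ v) ⊆ Metric.closedBall x (R / 2) := fun hsub => by
    have hlen := congrArg List.length hw
    simp only [List.length_append, List.length_cons, List.length_nil] at hlen
    exact hmin (u ++ v).length (by simp only [List.length_append]; omega) ⟨u ++ v, rfl, hx', hsub⟩
  obtain ⟨y, hy, hyR⟩ := not_subset.1 hnot
  rw [Metric.mem_closedBall, not_le] at hyR
  rw [piece_append] at hx' hy
  obtain ⟨a, ha, hax⟩ := hx'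
  obtain ⟨b, hb, rfl⟩ := hy
  rw [← hax] at hyR
  have hu0 := h.ratio_pos u
  have h1 : dist b a ≤ κ / (2 * K) := by
    refine (h.dist_le_of_mem_piece v hb ha).trans ?_
    rwa [hvl]
  have h2 := h.upper u b (h.piece_subset v hb) a (h.piece_subset v ha)
  have h3 : R < κ * ρ u := by
    have : R / 2 < κ * ρ u / 2 := by
      calc R / 2 < K * ρ u * dist b a := hyR.trans_le h2
        _ ≤ K * ρ u * (κ / (2 * K)) := by gcongr
        _ = κ * ρ u / 2 := by field_simp
    linarith
  rintro z ⟨hzR, hzF⟩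
  by_contra hzu
  have h4 := h.le_dist_of_notMem_piece (mem_image_of_mem _ (h.piece_subset v ha)) hzF hzu
  rw [Metric.mem_closedBall, dist_comm] at hzR
  rw [hax] at h4
  linarith

theorem exists_forall_ball_le [Finite Λ] (hm : IsQuasiMultiplicative φ F μ C)
    (h : IsQuasiSimilar φ F K c δ ρ) :
    ∃ s : ℝ, 0 < s ∧ ∃ A : ℝ, 0 < A ∧ ∀ x ∈ F, ∀ r R : ℝ, 0 < r → r < R →
      μ.real (Metric.closedBall x R) ≤ A * (R / r) ^ s * μ.real (Metric.closedBall x r) := by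
  have := hm.isProbabilityMeasure
  obtain ⟨D, hD, hDx⟩ := hm.exists_doubling h
  refine ⟨Real.logb 2 D, Real.logb_pos one_lt_two (by linarith), D, by linarith,
    fun x hx r R hr hrR => ?_⟩
  exact le_mul_rpow_of_doubling (f := fun t => μ.real (Metric.closedBall x t))
    (fun a b hab => measureReal_mono (Metric.closedBall_subset_closedBall hab))
    (fun _ => measureReal_nonneg) hD (hDx x hx) hr hrR

end IsQuasiMultiplicative

end Doubling

/-! ### Distortion of a single conformal map -/

section Distortion

variable {E : Type*} [NormedAddCommGroup E] [NormedSpace ℝ E]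

theorem norm_fderiv_apply_of_conformalAt [Nontrivial E] {f : E → E} {x : E}
    (h : ConformalAt f x) : 0 < ‖fderiv ℝ f x‖ ∧ ∀ v, ‖fderiv ℝ f x v‖ = ‖fderiv ℝ f x‖ * ‖v‖ := by
  obtain ⟨f', hf', a, ha, li, rfl⟩ := h
  rw [hf'.fderiv]
  have hnorm : ‖a • li.toContinuousLinearMap‖ = ‖a‖ := by
    rw [norm_smul, LinearIsometry.norm_toContinuousLinearMap, mul_one]
  rw [hnorm]
  exact ⟨norm_pos_iff.2 ha, fun v => by simp [norm_smul]⟩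

/-- Up to the factor `1 + M |x - y|^ε`, the map `f` scales the distance of `x` and `y` by the norm
of its derivative at `x`, and the latter is the norm of its derivative at `y`. -/
def IsComparable (f : E → E) (ε M : ℝ) (x y : E) : Prop :=
  ‖fderiv ℝ f x‖ * dist x y ≤ (1 + M * dist x y ^ ε) * dist (f x) (f y) ∧
  dist (f x) (f y) ≤ (1 + M * dist x y ^ ε) * (‖fderiv ℝ f x‖ * dist x y) ∧
  ‖fderiv ℝ f x‖ ≤ (1 + M * dist x y ^ ε) * ‖fderiv ℝ f y‖

theorem IsComparable.mono {f : E → E} {ε M N : ℝ} {x y : E} (h : IsComparable f ε M x y)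
    (hMN : M ≤ N) : IsComparable f ε N x y := by
  obtain ⟨h1, h2, h3⟩ := h
  have ht : 0 ≤ dist x y ^ ε := by positivity
  exact ⟨h1.trans (by gcongr), h2.trans (by gcongr), h3.trans (by gcongr)⟩

/-- Hölder continuity of the derivative and the mean value inequality on a segment in a small ball
give an error `C * dist x y ^ ε * dist x y` for the linearisation. Since the derivative scales all
vectors equally and its norm stays away from zero, the additive errors become relative ones. -/
theorem eventually_isComparable_self [Nontrivial E] {f : E → E} {x₀ : E} {ε : ℝ≥0} (hε : 0 < ε)
    (hconf : ∀ᶠ x in 𝓝 x₀, ConformalAt f x) {U : Set E} (hU : U ∈ 𝓝 x₀) {C : ℝ≥0}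
    (hH : HolderOnWith C ε (fderiv ℝ f) U) :
    ∃ M : ℝ, 0 ≤ M ∧ ∀ᶠ p : E × E in 𝓝 (x₀, x₀), IsComparable f ε M p.1 p.2 := by
  set a : E → ℝ := fun x => ‖fderiv ℝ f x‖ with ha
  have hε' : (0 : ℝ) < ε := hε
  have ha0 : 0 < a x₀ := (norm_fderiv_apply_of_conformalAt hconf.self_of_nhds).1
  have hcont : ContinuousAt a x₀ := ((hH.continuousOn hε).continuousAt hU).norm
  obtain ⟨r, hr, hball⟩ := Metric.mem_nhds_iff.1
    (inter_mem (inter_mem hU hconf) (hcont.eventually (lt_mem_nhds (half_lt_self ha0))))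
  have ht : ∀ᶠ p : E × E in 𝓝 (x₀, x₀), C * dist p.1 p.2 ^ (ε : ℝ) < a x₀ / 4 := by
    have h1 : ContinuousAt (fun p : E × E => (C : ℝ) * dist p.1 p.2 ^ (ε : ℝ)) (x₀, x₀) :=
      continuousAt_const.mul ((continuous_dist.continuousAt).rpow_const (Or.inr hε'.le))
    refine h1.eventually (gt_mem_nhds ?_)
    simp [Real.zero_rpow hε'.ne', ha0]
  have hb : ∀ᶠ p : E × E in 𝓝 (x₀, x₀), p ∈ Metric.ball x₀ r ×ˢ Metric.ball x₀ r :=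
    prod_mem_nhds (Metric.ball_mem_nhds _ hr) (Metric.ball_mem_nhds _ hr)
  -- Nearby `a x - C * t > a x₀ / 4`, with `t` the `ε`-th power of the distance; this `M` makes `M *
  -- t * (a x₀ / 4)` equal to `C * t`.
  refine ⟨4 * C / a x₀, by positivity, ?_⟩
  filter_upwards [ht, hb] with ⟨x, y⟩ hxy ⟨hx, hy⟩
  simp only at hxy hx hy
  obtain ⟨⟨hxU, hxc⟩, hxa⟩ := hball hx
  obtain ⟨⟨hyU, hyc⟩, hya⟩ := hball hy
  simp only [mem_ofPred_eq] at hxc hxa hyc hya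
  set t : ℝ := dist x y ^ (ε : ℝ) with htdef
  have ht0 : 0 ≤ t := by positivity
  have hseg : segment ℝ x y ⊆ Metric.ball x₀ r := (convex_ball x₀ r).segment_subset hx hy
  have hmv : ‖f y - f x - fderiv ℝ f x (y - x)‖ ≤ C * t * ‖y - x‖ := by
    refine Convex.norm_image_sub_le_of_norm_fderiv_le' (s := segment ℝ x y) (𝕜 := ℝ)
      (fun z hz => ?_) (fun z hz => ?_) (convex_segment x y)
      (left_mem_segment ℝ x y) (right_mem_segment ℝ x y)
    · exact (hball (hseg hz)).1.2.differentiableAt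
    · rw [← dist_eq_norm]
      refine (hH.dist_le (hball (hseg hz)).1.1 hxU).trans ?_
      refine mul_le_mul_of_nonneg_left (Real.rpow_le_rpow dist_nonneg ?_ hε'.le) C.2
      rw [dist_comm]
      have := dist_add_dist_of_mem_segment hz
      have := dist_nonneg (x := z) (y := y)
      linarith
  have hnorm := (norm_fderiv_apply_of_conformalAt hxc).2 (y - x)
  have hd : ‖y - x‖ = dist x y := by rw [dist_comm, dist_eq_norm]
  have hfd : dist (f x) (f y) = ‖f y - f x‖ := by rw [dist_comm, dist_eq_norm]
  rw [hd] at hnorm hmv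
  have h1 : a x * dist x y - C * t * dist x y ≤ dist (f x) (f y) := by
    have h4 := norm_sub_norm_le (fderiv ℝ f x (y - x)) (f y - f x)
    rw [norm_sub_rev (fderiv ℝ f x (y - x)) (f y - f x)] at h4
    rw [hfd]
    linarith
  have h2 : dist (f x) (f y) ≤ a x * dist x y + C * t * dist x y := by
    have := norm_sub_norm_le (f y - f x) (fderiv ℝ f x (y - x))
    rw [hfd]
    linarith
  have h3 : a x ≤ a y + C * t := by
    have h4 := norm_sub_norm_le (fderiv ℝ f x) (fderiv ℝ f y)
    rw [← dist_eq_norm] at h4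
    have h5 := hH.dist_le hxU hyU
    linarith
  have hCt : 0 ≤ C * t := by positivity
  have hMt : 4 * C / a x₀ * t * a x₀ = 4 * (C * t) := by field_simp
  set m : ℝ := 4 * C / a x₀ * t with hm
  have hm0 : 0 ≤ m := by positivity
  have hd0 : 0 ≤ dist x y := dist_nonneg
  refine ⟨?_, ?_, ?_⟩
  · calc a x * dist x y ≤ (1 + m) * (a x - C * t) * dist x y := by
          gcongr
          nlinarith [mul_nonneg hm0 (by linarith : 0 ≤ a x - C * t - a x₀ / 4)]
      _ = (1 + m) * (a x * dist x y - C * t * dist x y) := by ring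
      _ ≤ (1 + m) * dist (f x) (f y) := by gcongr
  · calc dist (f x) (f y) ≤ (a x + C * t) * dist x y := by linarith
      _ ≤ (1 + m) * a x * dist x y := by
          gcongr
          nlinarith [mul_nonneg hm0 (by linarith : 0 ≤ a x - a x₀ / 2)]
      _ = (1 + m) * (a x * dist x y) := by ring
  · show a x ≤ (1 + m) * a y
    nlinarith [mul_nonneg hm0 (by linarith : 0 ≤ a y - a x₀ / 2)]

/-- Away from the diagonal all quantities are continuous and positive, so any sufficiently large `M`
works. -/
theorem eventually_isComparable_of_ne [Nontrivial E] {f : E → E} {x₀ y₀ : E} {ε : ℝ}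
    (hne : x₀ ≠ y₀) (hfne : f x₀ ≠ f y₀) (hx : ConformalAt f x₀) (hy : ConformalAt f y₀)
    (hx' : ContinuousAt (fderiv ℝ f) x₀) (hy' : ContinuousAt (fderiv ℝ f) y₀) :
    ∃ M : ℝ, 0 ≤ M ∧ ∀ᶠ p : E × E in 𝓝 (x₀, y₀), IsComparable f ε M p.1 p.2 := by
  have hd0 : 0 < dist x₀ y₀ := dist_pos.2 hne
  have hfd0 : 0 < dist (f x₀) (f y₀) := dist_pos.2 hfne
  have hax := (norm_fderiv_apply_of_conformalAt hx).1
  have hay := (norm_fderiv_apply_of_conformalAt hy).1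
  have c1 : ContinuousAt (fun p : E × E => ‖fderiv ℝ f p.1‖) (x₀, y₀) :=
    (ContinuousAt.comp (f := Prod.fst) (g := fderiv ℝ f) hx' continuousAt_fst).norm
  have c2 : ContinuousAt (fun p : E × E => ‖fderiv ℝ f p.2‖) (x₀, y₀) :=
    (ContinuousAt.comp (f := Prod.snd) (g := fderiv ℝ f) hy' continuousAt_snd).norm
  have c3 : ContinuousAt (fun p : E × E => dist (f p.1) (f p.2)) (x₀, y₀) :=
    (ContinuousAt.comp (f := Prod.fst) (g := f) hx.differentiableAt.continuousAt
      continuousAt_fst).dist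
    (ContinuousAt.comp (f := Prod.snd) (g := f) hy.differentiableAt.continuousAt continuousAt_snd)
  have c4 : ContinuousAt (fun p : E × E => dist p.1 p.2) (x₀, y₀) := continuous_dist.continuousAt
  have c5 : ContinuousAt (fun p : E × E => dist p.1 p.2 ^ ε) (x₀, y₀) :=
    c4.rpow_const (Or.inl hd0.ne')
  have ht0 : 0 < dist x₀ y₀ ^ ε := by positivity
  have q1 := (c1.mul c4).div (c5.mul c3) (mul_pos ht0 hfd0).ne'
  have q2 := c3.div (c5.mul (c1.mul c4)) (mul_pos ht0 (mul_pos hax hd0)).ne'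
  have q3 := c1.div (c5.mul c2) (mul_pos ht0 hay).ne'
  obtain ⟨M, hM0, hM1, hM2, hM3⟩ : ∃ M : ℝ, 0 ≤ M ∧
      ‖fderiv ℝ f x₀‖ * dist x₀ y₀ / (dist x₀ y₀ ^ ε * dist (f x₀) (f y₀)) < M ∧
      dist (f x₀) (f y₀) / (dist x₀ y₀ ^ ε * (‖fderiv ℝ f x₀‖ * dist x₀ y₀)) < M ∧
      ‖fderiv ℝ f x₀‖ / (dist x₀ y₀ ^ ε * ‖fderiv ℝ f y₀‖) < M :=
    ((eventually_ge_atTop 0).and ((eventually_gt_atTop _).and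
      ((eventually_gt_atTop _).and (eventually_gt_atTop _)))).exists
  refine ⟨M, hM0, ?_⟩
  have hstep : ∀ {u v t : ℝ}, 0 < v → 0 < t → u / (t * v) < M → u ≤ (1 + M * t) * v := by
    intro u v t hv ht hu
    rw [div_lt_iff₀ (by positivity)] at hu
    nlinarith
  filter_upwards [c1.eventually (lt_mem_nhds hax), c2.eventually (lt_mem_nhds hay),
    c3.eventually (lt_mem_nhds hfd0), c4.eventually (lt_mem_nhds hd0),
    q1.eventually (gt_mem_nhds hM1), q2.eventually (gt_mem_nhds hM2),
    q3.eventually (gt_mem_nhds hM3)]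
    with p h1 h2 h3 h4 h5 h6 h7
  have h8 : 0 < dist p.1 p.2 ^ ε := by positivity
  exact ⟨hstep h3 h8 h5, hstep (by positivity) h8 h6, hstep h2 h8 h7⟩

/-- Compactness of `F × F` joins the diagonal and off-diagonal estimates. Segments are needed only
near the diagonal, so `Ω` need not be convex; injectivity handles distant pairs. -/
theorem exists_isComparable [Nontrivial E] {f : E → E} {Ω F : Set E} (hΩ : IsOpen Ω)
    (hF : IsCompact F) (hFΩ : F ⊆ Ω) (hinj : InjOn f Ω) (hconf : ∀ x ∈ Ω, ConformalAt f x)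
    {ε : ℝ≥0} (hε : 0 < ε)
    (hH : ∀ x ∈ Ω, ∃ U ∈ 𝓝 x, ∃ C : ℝ≥0, HolderOnWith C ε (fderiv ℝ f) U) :
    ∃ M : ℝ, 0 ≤ M ∧ ∀ x ∈ F, ∀ y ∈ F, IsComparable f ε M x y := by
  have hcont : ∀ x ∈ Ω, ContinuousAt (fderiv ℝ f) x := fun x hx => by
    obtain ⟨U, hU, C, hC⟩ := hH x hx
    exact (hC.continuousOn hε).continuousAt hU
  have key : ∃ M : ℝ, 0 ≤ M ∧ ∀ p ∈ F ×ˢ F, IsComparable f ε M p.1 p.2 := by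
    refine (hF.prod hF).induction_on
      (p := fun S => ∃ M : ℝ, 0 ≤ M ∧ ∀ p ∈ S, IsComparable f ε M p.1 p.2) ?_ ?_ ?_ ?_
    · exact ⟨0, le_rfl, by simp⟩
    · rintro S T hST ⟨M, hM0, hM⟩
      exact ⟨M, hM0, fun p hp => hM p (hST hp)⟩
    · rintro S T ⟨M, hM0, hM⟩ ⟨N, hN0, hN⟩
      refine ⟨max M N, le_max_of_le_left hM0, ?_⟩
      rintro p (hp | hp)
      · exact (hM p hp).mono (le_max_left _ _)
      · exact (hN p hp).mono (le_max_right _ _)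
    · rintro ⟨x₀, y₀⟩ ⟨hxF, hyF⟩
      have hx : x₀ ∈ Ω := hFΩ hxF
      have hy : y₀ ∈ Ω := hFΩ hyF
      have hloc : ∃ M : ℝ, 0 ≤ M ∧ ∀ᶠ p : E × E in 𝓝 (x₀, y₀), IsComparable f ε M p.1 p.2 := by
        by_cases hne : x₀ = y₀
        · subst hne
          obtain ⟨U, hU, C, hC⟩ := hH x₀ hx
          exact eventually_isComparable_self hε
            (Filter.mem_of_superset (hΩ.mem_nhds hx) hconf) hU hC
        · exact eventually_isComparable_of_ne hne (fun e => hne (hinj hx hy e)) (hconf _ hx)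
            (hconf _ hy) (hcont _ hx) (hcont _ hy)
      obtain ⟨M, hM0, hM⟩ := hloc
      exact ⟨_, mem_nhdsWithin_of_mem_nhds hM, M, hM0, fun p hp => hp⟩
  obtain ⟨M, hM0, hM⟩ := key
  exact ⟨M, hM0, fun x hx y hy => hM (x, y) ⟨hx, hy⟩⟩

end Distortion

/-! ### Bounded distortion along words -/

section Composition

variable {Λ E : Type*}

/-- The product of the local scaling factors `a` along a word. -/
noncomputable def scaling (φ : Λ → E → E) (a : Λ → E → ℝ) : List Λ → E → ℝ
  | [], _ => 1
  | i :: w, x => a i (wordMap φ w x) * scaling φ a w x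

theorem prod_one_add_geometric_le {M θ : ℝ} (hM : 0 ≤ M) (hθ : 0 ≤ θ) (hθ1 : θ < 1) (n : ℕ) :
    ∏ k ∈ Finset.range n, (1 + M * θ ^ k) ≤ Real.exp (M * (1 - θ)⁻¹) := by
  calc ∏ k ∈ Finset.range n, (1 + M * θ ^ k)
      ≤ ∏ k ∈ Finset.range n, Real.exp (M * θ ^ k) := by
        refine Finset.prod_le_prod (fun k _ => by positivity) fun k _ => ?_
        rw [add_comm]
        exact Real.add_one_le_exp _
    _ = Real.exp (M * ∑ k ∈ Finset.range n, θ ^ k) := by rw [Finset.mul_sum, Real.exp_sum]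
    _ ≤ Real.exp (M * (1 - θ)⁻¹) := by
        gcongr
        exact sum_le_hasSum _ (fun k _ => pow_nonneg hθ k) (hasSum_geometric_of_lt_one hθ hθ1)

/-- If each map of the system scales distances of points at distance at most `c ^ k * D` up to a
factor `1 + M θ ^ k`, then all compositions are similarities up to a uniform factor. -/
theorem exists_ratio_of_step [MetricSpace E] {φ : Λ → E → E} {F : Set E} (hF : F.Nonempty)
    (hmap : ∀ i, MapsTo (φ i) F F) {c D M θ : ℝ} (hc : 0 ≤ c)
    (hcon : ∀ i, ∀ x ∈ F, ∀ y ∈ F, dist (φ i x) (φ i y) ≤ c * dist x y)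
    (hD : ∀ x ∈ F, ∀ y ∈ F, dist x y ≤ D) (hM : 0 ≤ M) (hθ : 0 ≤ θ) (hθ1 : θ < 1)
    {a : Λ → E → ℝ} (ha : ∀ i, ∀ x ∈ F, 0 < a i x)
    (hstep : ∀ (i : Λ) (k : ℕ), ∀ x ∈ F, ∀ y ∈ F, dist x y ≤ c ^ k * D →
      a i x * dist x y ≤ (1 + M * θ ^ k) * dist (φ i x) (φ i y) ∧
      dist (φ i x) (φ i y) ≤ (1 + M * θ ^ k) * (a i x * dist x y) ∧
      a i x ≤ (1 + M * θ ^ k) * a i y) :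
    ∃ (K : ℝ) (ρ : List Λ → ℝ), 1 ≤ K ∧ (∀ w, 0 < ρ w) ∧
      (∀ w, ∀ x ∈ F, ∀ y ∈ F, dist (wordMap φ w x) (wordMap φ w y) ≤ K * ρ w * dist x y) ∧
      ∀ w, ∀ x ∈ F, ∀ y ∈ F, ρ w * dist x y ≤ K * dist (wordMap φ w x) (wordMap φ w y) := by
  have hmaps : ∀ w, MapsTo (wordMap φ w) F F := by
    intro w
    induction w with
    | nil => exact fun x hx => hx
    | cons i w ih => exact (hmap i).comp ih
  have hpow : ∀ w, ∀ x ∈ F, ∀ y ∈ F,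
      dist (wordMap φ w x) (wordMap φ w y) ≤ c ^ w.length * D := by
    intro w x hx y hy
    induction w with
    | nil => simpa [wordMap] using hD x hx y hy
    | cons i w ih =>
      calc dist (φ i (wordMap φ w x)) (φ i (wordMap φ w y))
          ≤ c * dist (wordMap φ w x) (wordMap φ w y) := hcon i _ (hmaps w hx) _ (hmaps w hy)
        _ ≤ c * (c ^ w.length * D) := by gcongr
        _ = c ^ (i :: w).length * D := by rw [List.length_cons]; ring
  have hpos : ∀ w, ∀ x ∈ F, 0 < scaling φ a w x := by
    intro w x hx
    induction w with
    | nil => exact one_pos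
    | cons i w ih => exact mul_pos (ha i _ (hmaps w hx)) ih
  set P : ℕ → ℝ := fun n => ∏ k ∈ Finset.range n, (1 + M * θ ^ k) with hP
  have hPs : ∀ n, P (n + 1) = P n * (1 + M * θ ^ n) := fun n => Finset.prod_range_succ _ _
  have hP0 : ∀ n, 0 ≤ P n := fun n => Finset.prod_nonneg fun k _ => by positivity
  -- The outer letter of `i :: w` acts on points at distance at most `c ^ w.length * D`, so it
  -- contributes exactly the next factor of `P`.
  have key : ∀ w, ∀ x ∈ F, ∀ y ∈ F,
      scaling φ a w x * dist x y ≤ P w.length * dist (wordMap φ w x) (wordMap φ w y) ∧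
      dist (wordMap φ w x) (wordMap φ w y) ≤ P w.length * (scaling φ a w x * dist x y) ∧
      scaling φ a w x ≤ P w.length * scaling φ a w y := by
    intro w x hx y hy
    induction w with
    | nil => simp [scaling, wordMap, hP]
    | cons i w ih =>
      obtain ⟨h1, h2, h3⟩ := ih
      obtain ⟨s1, s2, s3⟩ := hstep i w.length _ (hmaps w hx) _ (hmaps w hy) (hpow w x hx y hy)
      have hax := ha i _ (hmaps w hx)
      have hay := ha i _ (hmaps w hy)
      have hwx := hpos w x hx
      have hwy := hpos w y hy
      have hPw := hP0 w.length
      have hm : 0 ≤ 1 + M * θ ^ w.length := by positivity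
      rw [List.length_cons, hPs]
      refine ⟨?_, ?_, ?_⟩
      · calc a i (wordMap φ w x) * scaling φ a w x * dist x y
            = a i (wordMap φ w x) * (scaling φ a w x * dist x y) := by ring
          _ ≤ a i (wordMap φ w x) *
                (P w.length * dist (wordMap φ w x) (wordMap φ w y)) := by gcongr
          _ = P w.length *
                (a i (wordMap φ w x) * dist (wordMap φ w x) (wordMap φ w y)) := by ring
          _ ≤ P w.length * ((1 + M * θ ^ w.length) *
                dist (φ i (wordMap φ w x)) (φ i (wordMap φ w y))) := by gcongr
          _ = _ := (mul_assoc _ _ _).symm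
      · calc dist (φ i (wordMap φ w x)) (φ i (wordMap φ w y))
            ≤ (1 + M * θ ^ w.length) *
                (a i (wordMap φ w x) * dist (wordMap φ w x) (wordMap φ w y)) := s2
          _ ≤ (1 + M * θ ^ w.length) *
                (a i (wordMap φ w x) * (P w.length * (scaling φ a w x * dist x y))) := by gcongr
          _ = P w.length * (1 + M * θ ^ w.length) *
                (a i (wordMap φ w x) * scaling φ a w x * dist x y) := by ring
      · calc a i (wordMap φ w x) * scaling φ a w x
            ≤ (1 + M * θ ^ w.length) * a i (wordMap φ w y) *
                (P w.length * scaling φ a w y) := by gcongr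
          _ = P w.length * (1 + M * θ ^ w.length) *
                (a i (wordMap φ w y) * scaling φ a w y) := by ring
  obtain ⟨x₀, hx₀⟩ := hF
  set L : ℝ := Real.exp (M * (1 - θ)⁻¹) with hL
  have hL1 : 1 ≤ L := by
    have : 0 < 1 - θ := by linarith
    exact Real.one_le_exp (by positivity)
  have hPL : ∀ n, P n ≤ L := prod_one_add_geometric_le hM hθ hθ1
  -- The ratio is the scaling at a fixed base point: one factor `L` is the distortion, the other the
  -- change of base point.
  refine ⟨L ^ 2, fun w => scaling φ a w x₀, one_le_pow₀ hL1, fun w => hpos w x₀ hx₀,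
    fun w x hx y hy => ?_, fun w x hx y hy => ?_⟩
  · have hwx := hpos w x hx
    have hw0 := hpos w x₀ hx₀
    calc dist (wordMap φ w x) (wordMap φ w y)
        ≤ P w.length * (scaling φ a w x * dist x y) := (key w x hx y hy).2.1
      _ ≤ L * ((P w.length * scaling φ a w x₀) * dist x y) := by
          gcongr
          · exact hPL _
          · exact (key w x hx x₀ hx₀).2.2
      _ ≤ L * ((L * scaling φ a w x₀) * dist x y) := by gcongr; exact hPL _
      _ = L ^ 2 * scaling φ a w x₀ * dist x y := by ring
  · have hwx := hpos w x hx
    calc scaling φ a w x₀ * dist x y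
        ≤ (P w.length * scaling φ a w x) * dist x y := by
          gcongr
          exact (key w x₀ hx₀ x hx).2.2
      _ = P w.length * (scaling φ a w x * dist x y) := by ring
      _ ≤ L * (P w.length * dist (wordMap φ w x) (wordMap φ w y)) := by
          have h1 := (key w x hx y hy).1
          have hPw := hP0 w.length
          exact mul_le_mul (hPL _) h1 (by positivity) (by positivity)
      _ ≤ L * (L * dist (wordMap φ w x) (wordMap φ w y)) := by gcongr; exact hPL _
      _ = L ^ 2 * dist (wordMap φ w x) (wordMap φ w y) := by ring

end Composition

/-! ### Self-conformal systems are quasi-similar -/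

section Bridge

variable {Λ : Type*} [Finite Λ] {d : ℕ}
  {φ : Λ → EuclideanSpace ℝ (Fin d) → EuclideanSpace ℝ (Fin d)}
  {Ω X F : Set (EuclideanSpace ℝ (Fin d))}

theorem exists_uniform_contraction (hφ : IsSelfConformalIFS φ Ω X) (hF : IsLimitSet φ X F) :
    ∃ c : ℝ, 0 < c ∧ c < 1 ∧
      ∀ i, ∀ x ∈ F, ∀ y ∈ F, dist (φ i x) (φ i y) ≤ c * dist x y := by
  choose c hc1 hcL using hφ.contraction
  have := nonempty_of_eq_iUnion hF.nonempty hF.eq_iUnion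
  obtain ⟨i₀, hi₀⟩ := Finite.exists_max c
  -- The `1 / 2` only ensures a positive constant.
  refine ⟨max (c i₀) (1 / 2), by positivity, max_lt (by exact_mod_cast hc1 i₀) (by norm_num),
    fun i x hx y hy => ?_⟩
  refine ((hcL i).dist_le_mul x (hF.subset hx) y (hF.subset hy)).trans ?_
  gcongr
  exact le_max_of_le_left (by exact_mod_cast hi₀ i)

theorem exists_pos_separation (hφ : IsSelfConformalIFS φ Ω X) (hF : IsLimitSet φ X F)
    (hsep : StrongSeparation φ F) :
    ∃ δ : ℝ, 0 < δ ∧ ∀ i j, i ≠ j → ∀ x ∈ F, ∀ y ∈ F, δ ≤ dist (φ i x) (φ j y) := by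
  have hcompact : ∀ i, IsCompact (φ i '' F) := fun i => by
    obtain ⟨c, -, hc⟩ := hφ.contraction i
    exact hF.isCompact.image_of_continuousOn (hc.continuousOn.mono hF.subset)
  have hpair : ∀ q : Λ × Λ, ∃ δ : ℝ, 0 < δ ∧
      (q.1 ≠ q.2 → ∀ x ∈ F, ∀ y ∈ F, δ ≤ dist (φ q.1 x) (φ q.2 y)) := by
    rintro ⟨i, j⟩
    by_cases hij : i = j
    · exact ⟨1, one_pos, fun h => absurd hij h⟩
    · obtain ⟨r, hr, hr'⟩ := (hsep i j hij).exists_thickenings (hcompact i) (hcompact j).isClosed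
      refine ⟨r, hr, fun _ x hx y hy => ?_⟩
      by_contra! hlt
      refine Set.disjoint_left.1 hr'
        (Metric.self_subset_thickening hr _ (mem_image_of_mem _ hx)) ?_
      exact Metric.mem_thickening_iff.2 ⟨_, mem_image_of_mem _ hy, hlt⟩
  choose δ hδ hδ' using hpair
  have := nonempty_of_eq_iUnion hF.nonempty hF.eq_iUnion
  obtain ⟨q₀, hq₀⟩ := Finite.exists_min δ
  exact ⟨δ q₀, hδ q₀, fun i j hij x hx y hy => (hq₀ (i, j)).trans (hδ' (i, j) hij x hx y hy)⟩

theorem exists_isQuasiSimilar (hφ : IsSelfConformalIFS φ Ω X) (hF : IsLimitSet φ X F)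
    (hsep : StrongSeparation φ F) :
    ∃ (K c δ : ℝ) (ρ : List Λ → ℝ), IsQuasiSimilar φ F K c δ ρ := by
  obtain ⟨c, hc0, hc1, hcon⟩ := exists_uniform_contraction hφ hF
  obtain ⟨δ, hδ0, hδ⟩ := exists_pos_separation hφ hF hsep
  suffices hmain : ∃ (K : ℝ) (ρ : List Λ → ℝ), 1 ≤ K ∧ (∀ w, 0 < ρ w) ∧
      (∀ w, ∀ x ∈ F, ∀ y ∈ F, dist (wordMap φ w x) (wordMap φ w y) ≤ K * ρ w * dist x y) ∧
      ∀ w, ∀ x ∈ F, ∀ y ∈ F, ρ w * dist x y ≤ K * dist (wordMap φ w x) (wordMap φ w y) by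
    obtain ⟨K, ρ, hK, hρ, hup, hlow⟩ := hmain
    exact ⟨K, c, δ, ρ, hF.isCompact, hF.nonempty, hF.eq_iUnion, hK, hc0, hc1, hcon, hρ, hup, hlow,
      hδ0, hδ⟩
  -- For `d = 0` derivatives have norm zero and cannot serve as ratios, but all distances vanish.
  rcases subsingleton_or_nontrivial (EuclideanSpace ℝ (Fin d)) with hE | hE
  · refine ⟨1, fun _ => 1, le_rfl, fun _ => one_pos, fun w x _ y _ => ?_, fun w x _ y _ => ?_⟩ <;>
      simp [Subsingleton.elim x y]
  have hFΩ : F ⊆ Ω := hF.subset.trans hφ.subset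
  have hmap : ∀ i, MapsTo (φ i) F F := fun i x hx => by
    rw [hF.eq_iUnion]; exact mem_iUnion.2 ⟨i, mem_image_of_mem _ hx⟩
  set D : ℝ := Metric.diam F + 1 with hD
  have hD0 : 0 < D := by have := Metric.diam_nonneg (s := F); linarith
  have hdist : ∀ x ∈ F, ∀ y ∈ F, dist x y ≤ D := fun x hx y hy => by
    have := Metric.dist_le_diam_of_mem hF.isCompact.isBounded hx hy
    linarith
  choose ε hε hH using hφ.holder
  choose M hM0 hM using fun i => exists_isComparable hφ.isOpen hF.isCompact hFΩ (hφ.injOn i)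
    (hφ.conformal i) (hε i) (hH i)
  have := nonempty_of_eq_iUnion hF.nonempty hF.eq_iUnion
  -- At distance at most `c ^ k * D` the error of letter `i` is at most `M i * D ^ ε i * (c ^ ε i) ^
  -- k`; the coefficient and the base are maximised separately over the letters.
  obtain ⟨i₁, hi₁⟩ := Finite.exists_max fun i => M i * D ^ (ε i : ℝ)
  obtain ⟨i₂, hi₂⟩ := Finite.exists_max fun i => c ^ (ε i : ℝ)
  refine exists_ratio_of_step (M := M i₁ * D ^ (ε i₁ : ℝ)) (θ := c ^ (ε i₂ : ℝ))
    (a := fun i x => ‖fderiv ℝ (φ i) x‖) hF.nonempty hmap hc0.le hcon hdist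
    (mul_nonneg (hM0 i₁) (by positivity)) (by positivity)
    (Real.rpow_lt_one hc0.le hc1 (hε i₂))
    (fun i x hx => (norm_fderiv_apply_of_conformalAt (hφ.conformal i x (hFΩ hx))).1) ?_
  intro i k x hx y hy hxy
  have ht : M i * dist x y ^ (ε i : ℝ) ≤ M i₁ * D ^ (ε i₁ : ℝ) * (c ^ (ε i₂ : ℝ)) ^ k := by
    have hMi := hM0 i
    calc M i * dist x y ^ (ε i : ℝ) ≤ M i * (c ^ k * D) ^ (ε i : ℝ) := by gcongr
      _ = M i * D ^ (ε i : ℝ) * (c ^ (ε i : ℝ)) ^ k := by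
          rw [Real.mul_rpow (by positivity) hD0.le, ← Real.rpow_natCast c k,
            ← Real.rpow_mul hc0.le, ← Real.rpow_natCast (c ^ (ε i : ℝ)) k,
            ← Real.rpow_mul hc0.le, mul_comm (k : ℝ)]
          ring
      _ ≤ M i₁ * D ^ (ε i₁ : ℝ) * (c ^ (ε i₂ : ℝ)) ^ k := by
          have h1 := hi₁ i
          have h2 := hi₂ i
          have : 0 ≤ M i₁ * D ^ (ε i₁ : ℝ) := mul_nonneg (hM0 i₁) (by positivity)
          gcongr
  obtain ⟨h1, h2, h3⟩ := hM i x hx y hy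
  exact ⟨h1.trans (by gcongr), h2.trans (by gcongr), h3.trans (by gcongr)⟩

end Bridge

/-! ### From cylinders to pieces -/

section Coding

variable {Λ : Type*}

theorem length_wordPrefix (i : ℕ → Λ) (n : ℕ) : (wordPrefix i n).length = n := by
  simp [wordPrefix]

theorem mem_cylinder_iff {i : ℕ → Λ} {w : List Λ} :
    i ∈ cylinder w ↔ wordPrefix i w.length = w := by
  constructor
  · intro h
    refine List.ext_getElem (length_wordPrefix _ _) fun k hk hk' => ?_
    simp [wordPrefix, h k hk']
  · intro h k hk
    have : (wordPrefix i w.length)[k]'(by rwa [length_wordPrefix]) = i k := by simp [wordPrefix]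
    rw [← this]
    simp only [h]

variable [Finite Λ] {d : ℕ}
  {φ : Λ → EuclideanSpace ℝ (Fin d) → EuclideanSpace ℝ (Fin d)}
  {Ω X F : Set (EuclideanSpace ℝ (Fin d))} {K c δ : ℝ} {ρ : List Λ → ℝ}

theorem codingMap_mem_piece (hφ : IsSelfConformalIFS φ Ω X) (hF : IsLimitSet φ X F)
    (i : ℕ → Λ) (n : ℕ) : codingMap φ F i ∈ piece φ F (wordPrefix i n) := by
  have h := mem_singleton (codingMap φ F i)
  rw [singleton_codingMap hφ hF i] at h
  exact mem_iInter.1 h n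

/-- Pieces of equal level are disjoint, so the piece containing a coded point determines the prefix.
-/
theorem preimage_codingMap_piece (hφ : IsSelfConformalIFS φ Ω X) (hF : IsLimitSet φ X F)
    (h : IsQuasiSimilar φ F K c δ ρ) (w : List Λ) :
    codingMap φ F ⁻¹' piece φ F w = cylinder w := by
  ext i
  have hi := codingMap_mem_piece hφ hF i w.length
  rw [mem_cylinder_iff]
  constructor
  · intro hw
    by_contra hne
    exact Set.disjoint_left.1 (h.disjoint_piece (length_wordPrefix _ _) hne) hi hw
  · intro hw
    rwa [hw] at hi

theorem exists_isQuasiMultiplicative [MeasurableSpace Λ] (hφ : IsSelfConformalIFS φ Ω X)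
    (hF : IsLimitSet φ X F) (h : IsQuasiSimilar φ F K c δ ρ)
    {μ : Measure (EuclideanSpace ℝ (Fin d))} (hμ : IsQuasiBernoulliOn φ F μ)
    (hsupp : μ.support = F) : ∃ C, IsQuasiMultiplicative φ F μ C := by
  obtain ⟨ν, ⟨hν, C, hC, hqb⟩, rfl⟩ := hμ
  -- Otherwise `Measure.map` would be the zero measure, with empty support.
  have hae : AEMeasurable (codingMap φ F) ν := by
    by_contra hcon
    rw [Measure.map_of_not_aemeasurable hcon, Measure.support_zero] at hsupp
    exact hF.nonempty.ne_empty hsupp.symm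
  have hmass : ∀ w, (ν.map (codingMap φ F)).real (piece φ F w) = ν.real (cylinder w) := fun w => by
    rw [measureReal_def, Measure.map_apply_of_aemeasurable hae (h.isCompact_piece w).measurableSet,
      preimage_codingMap_piece hφ hF h, measureReal_def]
  have hC0 : 0 < C := by linarith
  have hprob : IsProbabilityMeasure (ν.map (codingMap φ F)) := Measure.isProbabilityMeasure_map hae
  have hcompl : (ν.map (codingMap φ F)) Fᶜ = 0 := by
    rw [Measure.map_apply_of_aemeasurable hae h.isCompact.measurableSet.compl]
    convert measure_empty (μ := ν)
    refine eq_empty_of_forall_notMem fun i hi => hi ?_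
    exact h.piece_subset _ (codingMap_mem_piece hφ hF i 0)
  refine ⟨C, hprob, hcompl, hC, fun u v => ?_, fun u v => ?_, fun w => ?_⟩
  · rw [hmass, hmass, hmass, ← inv_mul_le_iff₀ hC0, ← mul_assoc]
    exact (hqb u v).1
  · rw [hmass, hmass, hmass]
    exact (hqb u v).2
  · obtain ⟨x, hx⟩ := h.nonempty
    have hxw : wordMap φ w x ∈ piece φ F w := mem_image_of_mem _ hx
    -- A ball of this radius about a point of the piece meets `F` only inside the piece, so full
    -- support gives the piece positive mass.
    have hpos : 0 < δ / K ^ 3 * ρ w := by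
      have := h.one_le
      have := h.sep_pos
      have := h.ratio_pos w
      positivity
    have hmem : wordMap φ w x ∈ (ν.map (codingMap φ F)).support := by
      rw [hsupp]
      exact h.mapsTo w hx
    have hball := (Measure.mem_support_iff_forall _).1 hmem _ (Metric.ball_mem_nhds _ hpos)
    refine ENNReal.toReal_pos (hball.trans_le ?_).ne' (measure_ne_top _ _)
    calc _ ≤ (ν.map (codingMap φ F)) (piece φ F w ∪ Fᶜ) := measure_mono fun z hz => by
          by_cases hzF : z ∈ F
          · left
            by_contra hcon
            have h1 := h.le_dist_of_notMem_piece hxw hzF hcon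
            rw [Metric.mem_ball, dist_comm] at hz
            linarith
          · exact Or.inr hzF
      _ ≤ _ := measure_union_le _ _
      _ = _ := by rw [hcompl, add_zero]

end Coding

/-! ### Dimensions in terms of real-valued masses -/

section Dimension

variable {X : Type*} [PseudoMetricSpace X] [MeasurableSpace X]

theorem measure_closedBall_div_le_iff {μ : Measure X} [IsFiniteMeasure μ] {x : X}
    (hx : x ∈ μ.support) {r R t : ℝ} (hr : 0 < r) (ht : 0 ≤ t) :
    μ (Metric.closedBall x R) / μ (Metric.closedBall x r) ≤ ENNReal.ofReal t ↔
      μ.real (Metric.closedBall x R) ≤ t * μ.real (Metric.closedBall x r) := by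
  have hpos := (Measure.mem_support_iff_forall _).1 hx _ (Metric.closedBall_mem_nhds x hr)
  rw [ENNReal.div_le_iff hpos.ne' (measure_ne_top _ _),
    ← ENNReal.ofReal_toReal (measure_ne_top μ (Metric.closedBall x r)), ← ENNReal.ofReal_mul ht,
    ENNReal.le_ofReal_iff_toReal_le (measure_ne_top _ _) (mul_nonneg ht ENNReal.toReal_nonneg)]
  rfl

theorem pointwiseAssouadDim_le_assouadDim {μ : Measure X} {x : X} (hx : x ∈ μ.support) :
    pointwiseAssouadDim μ x ≤ assouadDim μ :=
  sInf_le_sInf fun _ ⟨s, hs, ht, C, hC, h⟩ => ⟨s, hs, ht, C, hC, h x hx⟩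

end Dimension

end PointwiseAssouad


/-! ### The main theorem -/

theorem mainTheorem1 {Λ : Type*} [Finite Λ] [MeasurableSpace Λ] [MeasurableSingletonClass Λ]
    {d : ℕ} (φ : Λ → EuclideanSpace ℝ (Fin d) → EuclideanSpace ℝ (Fin d))
    (Ω X F : Set (EuclideanSpace ℝ (Fin d)))
    (hφ : PointwiseAssouad.IsSelfConformalIFS φ Ω X)
    (hF : PointwiseAssouad.IsLimitSet φ X F)
    (hsep : PointwiseAssouad.StrongSeparation φ F)
    (μ : Measure (EuclideanSpace ℝ (Fin d)))
    (hμ : PointwiseAssouad.IsQuasiBernoulliOn φ F μ)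
    (hsupp : μ.support = F) :
    PointwiseAssouad.assouadDim μ < ∞ ∧
      ∀ᵐ x ∂μ, PointwiseAssouad.pointwiseAssouadDim μ x = PointwiseAssouad.assouadDim μ := by
  obtain ⟨K, c, δ, ρ, h⟩ := PointwiseAssouad.exists_isQuasiSimilar hφ hF hsep
  obtain ⟨C, hm⟩ := PointwiseAssouad.exists_isQuasiMultiplicative hφ hF h hμ hsupp
  have := hm.isProbabilityMeasure
  constructor
  · obtain ⟨s, hs, A, hA, hball⟩ := hm.exists_forall_ball_le h
    have hle : PointwiseAssouad.assouadDim μ ≤ ENNReal.ofReal s := by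
      refine sInf_le ⟨s, hs, rfl, A, hA, fun x hx r R hr hrR => ?_⟩
      have hR : 0 < R := hr.trans hrR
      rw [PointwiseAssouad.measure_closedBall_div_le_iff hx hr (by positivity)]
      exact hball x (hsupp ▸ hx) r R hr hrR
    exact hle.trans_lt ENNReal.ofReal_lt_top
  · have hF' : ∀ᵐ x ∂μ, x ∈ F := by
      rw [ae_iff]
      exact hm.compl
    filter_upwards [hm.ae_exists_mem_piece_append h, hF'] with x hx hxF
    have hxs : x ∈ μ.support := hsupp ▸ hxF
    refine le_antisymm (PointwiseAssouad.pointwiseAssouadDim_le_assouadDim hxs) ?_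
    -- Every exponent admissible at the typical point `x` is admissible globally.
    refine sInf_le_sInf ?_
    rintro t ⟨s, hs, ht, A, hA, hball⟩
    obtain ⟨B, hB, hBy⟩ := hm.exists_forall_ball_le_of_typical h hx hs hA fun r R hr hrR => by
      have hR : 0 < R := hr.trans hrR
      exact (PointwiseAssouad.measure_closedBall_div_le_iff hxs hr (by positivity)).1
        (hball r R hr hrR)
    refine ⟨s, hs, ht, B, hB, fun y hy r R hr hrR => ?_⟩
    have hR : 0 < R := hr.trans hrR
    rw [PointwiseAssouad.measure_closedBall_div_le_iff hy hr (by positivity)]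
    exact hBy y (hsupp ▸ hy) r R hr hrR
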